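/- Let $\Delta=\{z\in\mathbb C:|z|<1\}$. For $\alpha>-1$ let ${\bf A}^2_\alpha$ be the weighted Bergman space of all analytic functions $\phi$ in $\Delta$ with $$\|\phi\|_\alpha^2:=(\alpha+1)\iint_\Delta|\phi(z)|^2(1-|z|^2)^\alpha\,\frac{dx\,dy}{\pi}<\infty .$$ For $\beta>\alpha>-1$, an analytic function $g$ in $\Delta$ is called a multiplier from ${\bf A}^2_\alpha$ to ${\bf A}^2_\beta$ if $\phi\mapsto g\phi$ is a bounded operator from ${\bf A}^2_\alpha$ to ${\bf A}^2_\beta$, and its multiplier norm is $$\|g\|_{{\bf M}_{\alpha,\beta}}:=\sup_{\phi\in{\bf A}^2_\alpha,\ \phi\ne0}\frac{\|g\phi\|_\beta}{\|\phi\|_\alpha}.$$ For a univalent function $f$ in $\Delta$ with $f(0)=0$, $f'(0)=1$, let $F$ be the analytic branch in $\Delta\times\Delta$, with $F(0,0)=0$, of $$F(z,w)=\log\left(\frac{f(z)-f(w)}{z-w}\cdot\frac{z}{f(z)}\cdot\frac{w}{f(w)}\right)$$ (with the difference quotient read as $f'(z)$ for $z=w$, and $z/f(z)$ read as $1$ at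 $z=0$). For integers $p,q\ge1$ the higher-order Schwarzian derivative of $f$ is $$S_f^{[p,q]}(z):=\frac{\partial^{p+q}F}{\partial z^p\,\partial w^q}(z,z),\qquad z\in\Delta,$$ and $S_f=(f''/f')'-\tfrac12(f''/f')^2$ is the Schwarzian derivative of $f$. Let $\kappa(z)=z/(1-z)^2$ be the Koebe function. **Theorem.** Let $\alpha>-1$. For all integers $p,q\ge1$, the function $S_\kappa^{[p,q]}$ is a multiplier from ${\bf A}^2_\alpha$ to ${\bf A}^2_{\alpha+2p+2q}$, and $$\|S_\kappa^{[p,q]}\|_{{\bf M}_{\alpha,\alpha+2p+2q}}=\sqrt{\mathcal N_{\alpha,p,q}},$$ where $$\mathcal N_{\alpha,p,q}=\frac{[(p+q-1)!]^2}{2^{2p+2q}}\cdot\frac{\Gamma(\alpha+2+2p+2q)}{\Gamma(\alpha+2)}\cdot\left[\frac{\Gamma(\alpha/2+1)}{\Gamma(\alpha/2+1+p+q)}\right]^2 .$$ In the case $p=q=1$ this gives Shimorin's sharp estimate: $S_\kappa$ is a multiplier from ${\bf A}^2_\alpha$ to ${\bf A}^2_{\alpha+4}$, and $$\|S_\kappa\|_{{\bf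 M}_{\alpha,\alpha+4}}^2=\frac{36(\alpha+3)(\alpha+5)}{(\alpha+2)(\alpha+4)} .$$ -/

import Mathlib

/-- The open unit disk of the complex plane, as a set. -/
abbrev disk : Set ℂ := Metric.ball (0 : ℂ) 1

/-- The density of `‖φ‖_α²` before normalization: `|φ(z)|² (1 - |z|²)^α`. -/
noncomputable def bergmanDensity (α : ℝ) (φ : ℂ → ℂ) (z : ℂ) : ℝ :=
  ‖φ z‖ ^ 2 * (1 - ‖z‖ ^ 2) ^ α

/-- Membership in the weighted Bergman space `A²_α`: `φ` is analytic in the disk and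
`∬ |φ|² (1 - |z|²)^α dx dy < ∞`. Only the values of `φ` in the disk matter. -/
def MemBergman (α : ℝ) (φ : ℂ → ℂ) : Prop :=
  DifferentiableOn ℂ φ disk ∧ MeasureTheory.IntegrableOn (bergmanDensity α φ) disk

/-- The norm of `A²_α`: `‖φ‖_α² = (α + 1) ∬ |φ|² (1 - |z|²)^α dx dy / π`. -/
noncomputable def bergmanNorm (α : ℝ) (φ : ℂ → ℂ) : ℝ :=
  √((α + 1) * ((∫ z in disk, bergmanDensity α φ z) / Real.pi))

/-- `g` is a multiplier from `A²_α` to `A²_β`: `g` is analytic in the disk and `φ ↦ g φ` is a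
bounded operator from `A²_α` to `A²_β`. -/
def IsMultiplier (α β : ℝ) (g : ℂ → ℂ) : Prop :=
  DifferentiableOn ℂ g disk ∧
  (∀ φ : ℂ → ℂ, MemBergman α φ → MemBergman β (fun z => g z * φ z)) ∧
  ∃ C : ℝ, ∀ φ : ℂ → ℂ, MemBergman α φ →
    bergmanNorm β (fun z => g z * φ z) ≤ C * bergmanNorm α φ

/-- The multiplier norm: the supremum of `‖g φ‖_β / ‖φ‖_α` over all `φ ∈ A²_α` that do not vanish
identically in the disk. -/
noncomputable def multiplierNorm (α β : ℝ) (g : ℂ → ℂ) : ℝ :=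
  sSup {r : ℝ | ∃ φ : ℂ → ℂ, MemBergman α φ ∧ (∃ z ∈ disk, φ z ≠ 0) ∧
    r = bergmanNorm β (fun z => g z * φ z) / bergmanNorm α φ}

/-- The function `z / f z`, with the value `1 / f'(0)` at the removable singularity `0`
(for `f 0 = 0`). -/
noncomputable def idDiv (f : ℂ → ℂ) (z : ℂ) : ℂ :=
  if z = 0 then (deriv f 0)⁻¹ else z / f z

/-- The function `(f z - f w) / (z - w) * (z / f z) * (w / f w)`, where the difference quotient is
read as `f' z` for `z = w`. -/
noncomputable def grunskyQuotient (f : ℂ → ℂ) (z w : ℂ) : ℂ :=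
  (if z = w then deriv f z else (f z - f w) / (z - w)) * idDiv f z * idDiv f w

/-- `F` is the analytic branch in the bidisk of the logarithm of `grunskyQuotient f`, with
`F(0, 0) = 0`. -/
structure IsGrunskyLog (f : ℂ → ℂ) (F : ℂ → ℂ → ℂ) : Prop where
  analytic : DifferentiableOn ℂ (fun x : ℂ × ℂ => F x.1 x.2) (disk ×ˢ disk)
  exp_eq : ∀ z ∈ disk, ∀ w ∈ disk, Complex.exp (F z w) = grunskyQuotient f z w
  zero : F 0 0 = 0

/-- The analytic branch is determined on the bidisk. -/
theorem IsGrunskyLog.unique {f : ℂ → ℂ} {F G : ℂ → ℂ → ℂ} (hF : IsGrunskyLog f F)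
    (hG : IsGrunskyLog f G) {z w : ℂ} (hz : z ∈ disk) (hw : w ∈ disk) : F z w = G z w := by
  have hconn : IsPreconnected (disk ×ˢ disk : Set (ℂ × ℂ)) :=
    ((convex_ball (0 : ℂ) 1).prod (convex_ball (0 : ℂ) 1)).isPreconnected
  have h0 : (0 : ℂ) ∈ disk := by simp
  let k : ℂ × ℂ → ℝ := fun x => ((F x.1 x.2 - G x.1 x.2) / (2 * Real.pi * Complex.I)).re
  have hint : ∀ x ∈ (disk ×ˢ disk : Set (ℂ × ℂ)), ∃ n : ℤ,
      F x.1 x.2 = G x.1 x.2 + n * (2 * Real.pi * Complex.I) := fun x hx =>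
    Complex.exp_eq_exp_iff_exists_int.1
      ((hF.exp_eq _ hx.1 _ hx.2).trans (hG.exp_eq _ hx.1 _ hx.2).symm)
  have hk : ∀ x ∈ (disk ×ˢ disk : Set (ℂ × ℂ)), ∀ n : ℤ,
      F x.1 x.2 = G x.1 x.2 + n * (2 * Real.pi * Complex.I) → k x = n := by
    intro x _ n hn
    have : (F x.1 x.2 - G x.1 x.2) / (2 * Real.pi * Complex.I) = (n : ℂ) := by
      rw [hn, add_sub_cancel_left, mul_div_cancel_right₀ _ Complex.two_pi_I_ne_zero]
    simp only [k, this, Complex.intCast_re]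
  have hkc : ContinuousOn k (disk ×ˢ disk) :=
    Complex.continuous_re.comp_continuousOn
      ((hF.analytic.continuousOn.sub hG.analytic.continuousOn).div_const _)
  have hdisc : IsDiscrete (Set.range ((↑) : ℤ → ℝ)) :=
    ⟨Int.isClosedEmbedding_coe_real.toHomeomorph.symm.isEmbedding.discreteTopology⟩
  have hconst := hconn.constant_of_mapsTo (T := Set.range ((↑) : ℤ → ℝ)) hdisc
    (f := k) hkc (fun x hx => by
      obtain ⟨n, hn⟩ := hint x hx
      exact ⟨n, (hk x hx n hn).symm⟩)
    (x := (z, w)) (y := (0, 0)) ⟨hz, hw⟩ ⟨h0, h0⟩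
  obtain ⟨n, hn⟩ := hint (z, w) ⟨hz, hw⟩
  have h1 := hk (z, w) ⟨hz, hw⟩ n hn
  have h2 : k (0, 0) = 0 := by simp [k, hF.zero, hG.zero]
  have hn0 : n = 0 := by
    have : (n : ℝ) = 0 := by rw [← h1, hconst, h2]
    exact_mod_cast this
  simpa [hn0] using hn

open Classical in
/-- The analytic branch in the bidisk of
`log ((f z - f w) / (z - w) * (z / f z) * (w / f w))` that vanishes at the origin. It exists for
every univalent `f` in the disk with `f 0 = 0` and `f' 0 = 1`. -/
noncomputable def grunskyLog (f : ℂ → ℂ) : ℂ → ℂ → ℂ :=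
  if h : ∃ F, IsGrunskyLog f F then h.choose else 0

/-- The higher-order Schwarzian derivative: `∂^{p+q} F / ∂z^p ∂w^q` on the diagonal. -/
noncomputable def higherSchwarzian (f : ℂ → ℂ) (p q : ℕ) (z : ℂ) : ℂ :=
  iteratedDeriv p (fun ζ => iteratedDeriv q (fun ω => grunskyLog f ζ ω) z) z

/-- The Schwarzian derivative `(f'' / f')' - (f'' / f')² / 2`. -/
noncomputable def schwarzian (f : ℂ → ℂ) (z : ℂ) : ℂ :=
  deriv (fun ζ => deriv (deriv f) ζ / deriv f ζ) z
    - 1 / 2 * (deriv (deriv f) z / deriv f z) ^ 2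

/-- The Koebe function. -/
noncomputable def koebe (z : ℂ) : ℂ := z / (1 - z) ^ 2

/-- The branch exists for the Koebe function, so that `grunskyLog koebe` is this branch. -/
theorem isGrunskyLog_koebe : IsGrunskyLog koebe (fun z w => Complex.log (1 - z * w)) := by
  have hne : ∀ z ∈ disk, (1 : ℂ) - z ≠ 0 := by
    intro z hz h
    rw [mem_ball_zero_iff, ← sub_eq_zero.1 h] at hz
    simp at hz
  have hslit : ∀ z ∈ disk, ∀ w ∈ disk, 1 - z * w ∈ Complex.slitPlane := by
    intro z hz w hw
    rw [mem_ball_zero_iff] at hz hw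
    have : ‖-(z * w)‖ < 1 := by
      rw [norm_neg, norm_mul]
      nlinarith [norm_nonneg z, norm_nonneg w]
    simpa [sub_eq_add_neg] using Complex.mem_slitPlane_of_norm_lt_one this
  have hd : ∀ z ∈ disk, deriv koebe z = (1 + z) / (1 - z) ^ 3 := by
    intro z hz
    have h1 := hne z hz
    have h := (hasDerivAt_id z).div (((hasDerivAt_id z).const_sub 1).pow 2) (pow_ne_zero 2 h1)
    refine (h.congr_deriv ?_).deriv
    simp only [id, Pi.pow_apply]
    field_simp
    push_cast
    ring
  have hi : ∀ z ∈ disk, idDiv koebe z = (1 - z) ^ 2 := by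
    intro z hz
    unfold idDiv
    split_ifs with h
    · subst h
      rw [hd 0 hz]
      simp
    · have h1 := hne z hz
      unfold koebe
      field_simp
  refine ⟨?_, ?_, by simp⟩
  · intro x hx
    refine DifferentiableAt.differentiableWithinAt ?_
    exact DifferentiableAt.clog (by fun_prop) (hslit _ hx.1 _ hx.2)
  · intro z hz w hw
    rw [Complex.exp_log (Complex.slitPlane_ne_zero (hslit z hz w hw))]
    unfold grunskyQuotient
    rw [hi z hz, hi w hw]
    have h1 := hne z hz
    have h2 := hne w hw
    split_ifs with h
    · subst h
      rw [hd z hz]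
      field_simp
      ring
    · have h3 : z - w ≠ 0 := sub_ne_zero.2 h
      unfold koebe
      field_simp
      ring

/-- The constant `N_{α,p,q}`. -/
noncomputable def koebeConst (α : ℝ) (p q : ℕ) : ℝ :=
  ((p + q - 1).factorial : ℝ) ^ 2 / 2 ^ (2 * p + 2 * q)
    * (Real.Gamma (α + 2 + 2 * p + 2 * q) / Real.Gamma (α + 2))
    * (Real.Gamma (α / 2 + 1) / Real.Gamma (α / 2 + 1 + p + q)) ^ 2

/-! For the Koebe function the logarithm is `log (1 - z w)`. Differentiating it `q` times in `w` and
`p` times in `z` and restricting to the diagonal gives `-P(z) / (1 - z²)ⁿ` with `n = p + q`. The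
polynomial `P` has nonnegative coefficients of sum `A = (n - 1)!` and only exponents of the parity
of `n`. Hence `|P| ≤ A` in the disk, and everything reduces to division by powers of `1 - z²`.

Upper bound. Monomials are orthogonal in a weighted Bergman space, so norms are weighted sums of
squared Taylor coefficients (`HasDiskCoeffs.lintegral_bergmanDensity`). In these terms, the estimate
that division by `1 - z²` maps `A²_a` to `A²_{a+2}` with squared unnormalized norm at most `(a + 1)
/ (a + 2)` is a discrete Hardy inequality (`sum_sq_norm_mul_weight_le`), proved by telescoping.
Iterating `n` times gives the product `koebeProd α n`.

Sharpness. The formal extremal of the Hardy inequality is `(1 - z²) ^ (-(a + 2) / 2)`, which just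
fails to lie in `A²_a`. Dividing it by `1 - z²` yields the formal extremal for `a + 2`, so iteration
loses nothing. Its Taylor polynomials serve as test functions: the ratios of weighted squared
coefficients after and before division by `(1 - z²)ⁿ` tend to `koebeProd α n`
(`tendsto_hypCoeff_ratio`). Since the denominators have divergent sum (`not_summable_hypCoeff`), the
ratios of partial sums come as close to that limit as desired. The numerator `P` costs nothing,
because its coefficients have one sign and its exponents one parity, so that it has modulus `A` at
both singular points `±1`. -/

/-! ### Parseval's identity and the Bergman norm in Taylor coefficients -/

open MeasureTheory AddCircle in
/-- Parseval's identity for an absolutely convergent one-sided Fourier series. -/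
theorem hasSum_sq_norm_of_summable_fourier [Fact (0 < 2 * Real.pi)] {c : ℕ → ℂ}
    {F : C(AddCircle (2 * Real.pi), ℂ)}
    (hF : HasSum (fun k : ℕ => c k • fourier (k : ℤ)) F) :
    HasSum (fun k => ‖c k‖ ^ 2) (∫ t, ‖F t‖ ^ 2 ∂haarAddCircle) := by
  have hL : HasSum (fun k : ℕ => c k • fourierLp (T := 2 * Real.pi) 2 (k : ℤ))
      (F.toLp 2 haarAddCircle ℂ) := by
    simpa [fourierLp] using hF.mapL (ContinuousMap.toLp (E := ℂ) 2 haarAddCircle ℂ)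
  -- Orthonormality reads off the Fourier coefficients; those of negative index vanish, which later
  -- turns the sum over `ℤ` into one over `ℕ`.
  have hcoeff : ∀ n : ℤ, fourierCoeff (F.toLp 2 haarAddCircle ℂ) n
      = if 0 ≤ n then c n.toNat else 0 := by
    intro n
    rw [← fourierBasis_repr, HilbertBasis.repr_apply_apply, coe_fourierBasis]
    have h := hL.mapL (innerSL ℂ (fourierLp (T := 2 * Real.pi) 2 n))
    simp only [innerSL_apply_apply, inner_smul_right] at h
    have ho := orthonormal_iff_ite.1 (orthonormal_fourier (T := 2 * Real.pi))
    simp only [ho] at h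
    refine h.unique ?_
    split_ifs with hn
    · lift n to ℕ using hn
      have : (fun k : ℕ => c k * if (n : ℤ) = k then 1 else 0)
          = fun k => if k = n then c n else 0 := by
        funext k
        by_cases hk : k = n
        · simp [hk]
        · simp [hk, Ne.symm hk]
      rw [this]
      simpa using hasSum_ite_eq n (c n)
    · have : (fun k : ℕ => c k * if n = k then 1 else 0) = fun _ => 0 := by
        funext k
        rw [if_neg (by omega), mul_zero]
      rw [this]
      exact hasSum_zero
  have h := hasSum_sq_fourierCoeff (F.toLp 2 haarAddCircle ℂ)
  simp only [hcoeff] at h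
  have hint : ∫ t, ‖(F.toLp 2 haarAddCircle ℂ) t‖ ^ 2 ∂haarAddCircle
      = ∫ t, ‖F t‖ ^ 2 ∂haarAddCircle := by
    refine integral_congr_ae ?_
    filter_upwards [ContinuousMap.coeFn_toLp (p := 2) haarAddCircle (𝕜 := ℂ) F] with t ht
    rw [ht]
  rw [hint] at h
  rw [← (Nat.cast_injective (R := ℤ)).hasSum_iff (f := fun n : ℤ =>
    ‖if 0 ≤ n then c n.toNat else 0‖ ^ 2)] at h
  · simpa [Function.comp_def] using h
  · intro n hn
    rw [if_neg]
    · simp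
    · intro h0
      exact hn ⟨n.toNat, by simp [h0]⟩

-- Absolute convergence of the coefficients makes the series converge uniformly on the circle, so
-- `g` lifts to a continuous function there and Parseval applies. The factor `2π` undoes the
-- normalization of Haar measure.
open MeasureTheory AddCircle in
theorem lintegral_sq_norm_tsum_exp {c : ℕ → ℂ} (hc : Summable fun k => ‖c k‖) {g : ℝ → ℂ}
    (hg : ∀ θ : ℝ, HasSum (fun k : ℕ => c k * Complex.exp (θ * Complex.I) ^ k) (g θ)) :
    ∫⁻ θ in Set.Ioo (-Real.pi) Real.pi, ENNReal.ofReal (‖g θ‖ ^ 2)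
      = ENNReal.ofReal (2 * Real.pi) * ∑' k, ENNReal.ofReal (‖c k‖ ^ 2) := by
  have : Fact (0 < 2 * Real.pi) := ⟨by positivity⟩
  have hs : Summable (fun k : ℕ => c k • (fourier (k : ℤ) : C(AddCircle (2 * Real.pi), ℂ))) := by
    refine Summable.of_norm ?_
    simpa [norm_smul, fourier_norm] using hc
  obtain ⟨F, hF⟩ := hs
  have hFg : ∀ θ : ℝ, F (θ : AddCircle (2 * Real.pi)) = g θ := by
    intro θ
    refine HasSum.unique ?_ (hg θ)
    have h := hF.mapL (ContinuousMap.evalCLM ℂ (θ : AddCircle (2 * Real.pi)))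
    convert h using 2 with k
    have : fourier (T := 2 * Real.pi) (k : ℤ) (θ : AddCircle (2 * Real.pi))
        = Complex.exp (θ * Complex.I) ^ k := by
      rw [fourier_coe_apply, ← Complex.exp_nat_mul]
      congr 1
      have : (Real.pi : ℂ) ≠ 0 := by exact_mod_cast Real.pi_ne_zero
      push_cast
      field_simp
    simp [ContinuousMap.evalCLM, this, -fourier_apply]
    rfl
  have hgc : Continuous g := by
    have : g = fun θ : ℝ => F (θ : AddCircle (2 * Real.pi)) := funext fun θ => (hFg θ).symm
    rw [this]
    exact F.continuous.comp (AddCircle.continuous_mk' _)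
  have hP := hasSum_sq_norm_of_summable_fourier hF
  rw [AddCircle.integral_haarAddCircle, ← AddCircle.intervalIntegral_preimage (2 * Real.pi)
    (-Real.pi)] at hP
  simp only [hFg] at hP
  rw [show -Real.pi + 2 * Real.pi = Real.pi by ring,
    intervalIntegral.integral_of_le (by linarith [Real.pi_pos]), integral_Ioc_eq_integral_Ioo] at hP
  have hint : IntegrableOn (fun θ => ‖g θ‖ ^ 2) (Set.Ioo (-Real.pi) Real.pi) :=
    ((by fun_prop : Continuous fun θ => ‖g θ‖ ^ 2).integrableOn_Icc).mono_set
      Set.Ioo_subset_Icc_self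
  rw [← ofReal_integral_eq_lintegral_ofReal hint (Filter.Eventually.of_forall fun _ => by positivity),
    ← ENNReal.ofReal_tsum_of_nonneg (fun _ => by positivity) hP.summable, hP.tsum_eq,
    ← ENNReal.ofReal_mul (by positivity), smul_eq_mul]
  congr 1
  field_simp

/-- `φ` has the power series expansion with coefficients `c` in the unit disk. -/
def HasDiskCoeffs (c : ℕ → ℂ) (φ : ℂ → ℂ) : Prop :=
  ∀ z ∈ disk, HasSum (fun k => c k * z ^ k) (φ z)

/-- The squared norm of the monomial `z ^ k` with respect to `(1 - |z|²)^a dx dy / π`. -/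
noncomputable def bergmanWeight (a : ℝ) (k : ℕ) : ℝ :=
  ProbabilityTheory.beta (k + 1) (a + 1)

theorem bergmanWeight_pos {a : ℝ} (ha : -1 < a) (k : ℕ) : 0 < bergmanWeight a k :=
  ProbabilityTheory.beta_pos (by positivity) (by linarith)

open MeasureTheory in
theorem lintegral_pow_mul_rpow {a : ℝ} (ha : -1 < a) (k : ℕ) :
    ∫⁻ x in Set.Ioo (0 : ℝ) 1, ENNReal.ofReal (x ^ k * (1 - x) ^ a)
      = ENNReal.ofReal (bergmanWeight a k) := by
  have h := ProbabilityTheory.lintegral_betaPDF_eq_one (α := k + 1) (β := a + 1) (by positivity)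
    (by linarith)
  have hW := bergmanWeight_pos ha k
  rw [ProbabilityTheory.lintegral_betaPDF] at h
  change ∫⁻ x in Set.Ioo (0 : ℝ) 1, ENNReal.ofReal (1 / bergmanWeight a k * _ * _) = 1 at h
  simp only [add_sub_cancel_right, Real.rpow_natCast, mul_assoc] at h
  have h2 : ∀ x : ℝ, ENNReal.ofReal (1 / bergmanWeight a k * (x ^ k * (1 - x) ^ a))
      = ENNReal.ofReal (1 / bergmanWeight a k) * ENNReal.ofReal (x ^ k * (1 - x) ^ a) :=
    fun x => ENNReal.ofReal_mul (by positivity)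
  simp only [h2] at h
  rw [lintegral_const_mul' _ _ ENNReal.ofReal_ne_top] at h
  calc _ = ENNReal.ofReal (bergmanWeight a k) * (ENNReal.ofReal (1 / bergmanWeight a k) *
        ∫⁻ x in Set.Ioo (0 : ℝ) 1, ENNReal.ofReal (x ^ k * (1 - x) ^ a)) := by
        rw [← mul_assoc, ← ENNReal.ofReal_mul hW.le, mul_one_div_cancel hW.ne']
        simp
    _ = _ := by rw [h, mul_one]

-- The substitution `x = r²` turns the radial integral into a Beta integral.
open MeasureTheory in
theorem lintegral_radial {a : ℝ} (ha : -1 < a) (k : ℕ) :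
    ∫⁻ r in Set.Ioo (0 : ℝ) 1, ENNReal.ofReal (2 * r) * ENNReal.ofReal ((r ^ 2) ^ k * (1 - r ^ 2) ^ a)
      = ENNReal.ofReal (bergmanWeight a k) := by
  have himg : (fun r : ℝ => r ^ 2) '' Set.Ioo 0 1 = Set.Ioo 0 1 := by
    ext x
    constructor
    · rintro ⟨r, ⟨h0, h1⟩, rfl⟩
      exact ⟨by positivity, by nlinarith⟩
    · rintro ⟨h0, h1⟩
      exact ⟨√x, ⟨Real.sqrt_pos.2 h0, by rw [Real.sqrt_lt' one_pos]; simpa using h1⟩,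
        Real.sq_sqrt h0.le⟩
  have hmono : MonotoneOn (fun r : ℝ => r ^ 2) (Set.Ioo 0 1) :=
    fun x hx y _ hxy => pow_le_pow_left₀ hx.1.le hxy 2
  have h := lintegral_image_eq_lintegral_deriv_mul_of_monotoneOn (f' := fun r => 2 * r)
    measurableSet_Ioo (fun x _ => by simpa using ((hasDerivAt_pow 2 x).hasDerivWithinAt)) hmono
    (fun x => ENNReal.ofReal (x ^ k * (1 - x) ^ a))
  rw [himg, lintegral_pow_mul_rpow ha] at h
  exact h.symm

theorem continuousOn_bergmanDensity (a : ℝ) {φ : ℂ → ℂ} (hφ : ContinuousOn φ disk) :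
    ContinuousOn (bergmanDensity a φ) disk := by
  refine (hφ.norm.pow 2).mul ?_
  refine ContinuousOn.rpow_const (by fun_prop) fun z hz => Or.inl ?_
  rw [mem_ball_zero_iff] at hz
  nlinarith [norm_nonneg z]

open MeasureTheory in
/-- The weighted Bergman norm in terms of the Taylor coefficients. -/
theorem HasDiskCoeffs.lintegral_bergmanDensity {a : ℝ} (ha : -1 < a) {c : ℕ → ℂ} {φ : ℂ → ℂ}
    (hφ : ContinuousOn φ disk) (h : HasDiskCoeffs c φ) :
    ∫⁻ z in disk, ENNReal.ofReal (bergmanDensity a φ z)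
      = ENNReal.ofReal Real.pi * ∑' k, ENNReal.ofReal (‖c k‖ ^ 2 * bergmanWeight a k) := by
  classical
  have hm : Measurable (disk.indicator fun z => ENNReal.ofReal (bergmanDensity a φ z)) := by
    rw [← Set.piecewise_eq_indicator]
    exact ContinuousOn.measurable_piecewise
      (ENNReal.continuous_ofReal.comp_continuousOn (continuousOn_bergmanDensity a hφ))
      continuousOn_const measurableSet_ball
  rw [← lintegral_indicator measurableSet_ball, ← Complex.lintegral_comp_polarCoord_symm]
  rw [show polarCoord.target = Set.Ioi (0 : ℝ) ×ˢ Set.Ioo (-Real.pi) Real.pi from rfl,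
    Measure.volume_eq_prod, ← Measure.prod_restrict, lintegral_prod]
  swap
  · have hp : Measurable fun p : ℝ × ℝ => Complex.polarCoord.symm p := by
      simp only [Complex.polarCoord_symm_apply]
      fun_prop
    exact ((ENNReal.measurable_ofReal.comp measurable_fst).mul (hm.comp hp)).aemeasurable
  have hin : ∀ r ∈ Set.Ioi (0 : ℝ), (∫⁻ θ in Set.Ioo (-Real.pi) Real.pi, ENNReal.ofReal r •
      disk.indicator (fun z => ENNReal.ofReal (bergmanDensity a φ z))
        (Complex.polarCoord.symm (r, θ)))
      = (Set.Ioo (0 : ℝ) 1).indicator (fun r => ENNReal.ofReal Real.pi *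
        ∑' k, ENNReal.ofReal (‖c k‖ ^ 2) * (ENNReal.ofReal (2 * r) *
          ENNReal.ofReal ((r ^ 2) ^ k * (1 - r ^ 2) ^ a))) r := by
    intro r hr
    have hr0 : 0 < r := hr
    have hz : ∀ θ : ℝ, Complex.polarCoord.symm (r, θ) = r * Complex.exp (θ * Complex.I) := by
      intro θ
      rw [Complex.polarCoord_symm_apply, Complex.exp_mul_I]
      simp
    have hn : ∀ θ : ℝ, ‖(r * Complex.exp (θ * Complex.I) : ℂ)‖ = r := by
      intro θ
      rw [norm_mul, Complex.norm_exp_ofReal_mul_I, mul_one, Complex.norm_real, Real.norm_eq_abs,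
        abs_of_pos hr0]
    simp only [hz]
    by_cases hr1 : r < 1
    · have hmem : ∀ θ : ℝ, (r * Complex.exp (θ * Complex.I) : ℂ) ∈ disk := fun θ => by
        rw [mem_ball_zero_iff, hn]; exact hr1
      have hs : Summable fun k => ‖c k * (r : ℂ) ^ k‖ := by
        have := (h r (by simpa [abs_of_pos hr0] using hr1)).summable
        exact this.norm
      -- Parseval on the circle of radius `r`, with coefficients `c k * r ^ k`.
      have hP := lintegral_sq_norm_tsum_exp hs
        (g := fun θ => φ (r * Complex.exp (θ * Complex.I))) (fun θ => by
          have := h _ (hmem θ)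
          simpa only [mul_pow, mul_assoc] using this)
      have hb : 0 ≤ (1 - r ^ 2) ^ a := Real.rpow_nonneg (by nlinarith) _
      simp only [Set.indicator_of_mem (hmem _), Set.indicator_of_mem (show r ∈ Set.Ioo 0 1 from
        ⟨hr0, hr1⟩), bergmanDensity, hn, smul_eq_mul]
      simp only [ENNReal.ofReal_mul (sq_nonneg ‖_‖)]
      rw [lintegral_const_mul' _ _ ENNReal.ofReal_ne_top, lintegral_mul_const' _ _
        ENNReal.ofReal_ne_top, hP, ENNReal.ofReal_mul two_pos.le, mul_comm (ENNReal.ofReal 2),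
        mul_assoc, mul_assoc, mul_left_comm (ENNReal.ofReal r)]
      congr 1
      rw [← mul_assoc, ← ENNReal.ofReal_mul hr0.le, ← ENNReal.tsum_mul_right,
        ← ENNReal.tsum_mul_left]
      refine tsum_congr fun k => ?_
      rw [← ENNReal.ofReal_mul (by positivity), ← ENNReal.ofReal_mul (by positivity),
        ← ENNReal.ofReal_mul (by positivity), ← ENNReal.ofReal_mul (by positivity), norm_mul,
        norm_pow, Complex.norm_real, Real.norm_eq_abs, abs_of_pos hr0]
      congr 1
      ring
    · have hmem : ∀ θ : ℝ, (r * Complex.exp (θ * Complex.I) : ℂ) ∉ disk := fun θ => by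
        rw [mem_ball_zero_iff, hn]; exact hr1
      rw [Set.indicator_of_notMem (fun h => hr1 h.2)]
      simp [Set.indicator_of_notMem (hmem _)]
  rw [setLIntegral_congr_fun measurableSet_Ioi hin, setLIntegral_indicator measurableSet_Ioo,
    Set.inter_eq_left.2 (fun x hx => hx.1), lintegral_const_mul' _ _ ENNReal.ofReal_ne_top]
  congr 1
  rw [lintegral_tsum (fun k => by fun_prop)]
  refine tsum_congr fun k => ?_
  rw [lintegral_const_mul' _ _ ENNReal.ofReal_ne_top, lintegral_radial ha,
    ← ENNReal.ofReal_mul (by positivity)]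

/-! ### Hardy's inequality and division by `1 - z²` -/

theorem bergmanWeight_succ {a : ℝ} (ha : -1 < a) (k : ℕ) :
    bergmanWeight a (k + 1) * (k + a + 2) = (k + 1) * bergmanWeight a k := by
  unfold bergmanWeight ProbabilityTheory.beta
  have hk : (0 : ℝ) ≤ k := k.cast_nonneg
  have h1 : Real.Gamma ((k + 1 : ℕ) + 1) = (k + 1) * Real.Gamma (k + 1) := by
    push_cast
    exact Real.Gamma_add_one (by positivity)
  have h2 : Real.Gamma ((k + 1 : ℕ) + 1 + (a + 1)) = (k + a + 2) * Real.Gamma (k + 1 + (a + 1)) := by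
    rw [show ((k + 1 : ℕ) + 1 + (a + 1) : ℝ) = (k + 1 + (a + 1)) + 1 by push_cast; ring,
      Real.Gamma_add_one (by linarith)]
    ring
  have h3 : Real.Gamma (k + 1 + (a + 1)) ≠ 0 := (Real.Gamma_pos_of_pos (by linarith)).ne'
  have h4 : (k + a + 2 : ℝ) ≠ 0 := by linarith
  rw [h1, h2]
  field_simp

theorem bergmanWeight_add_one {a : ℝ} (ha : -1 < a) (k : ℕ) :
    bergmanWeight (a + 1) k * (k + a + 2) = (a + 1) * bergmanWeight a k := by
  unfold bergmanWeight ProbabilityTheory.beta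
  have hk : (0 : ℝ) ≤ k := k.cast_nonneg
  have h1 : Real.Gamma (a + 1 + 1) = (a + 1) * Real.Gamma (a + 1) :=
    Real.Gamma_add_one (by linarith)
  have h2 : Real.Gamma (k + 1 + (a + 1 + 1)) = (k + a + 2) * Real.Gamma (k + 1 + (a + 1)) := by
    rw [← add_assoc, Real.Gamma_add_one (by linarith)]
    ring
  have h3 : Real.Gamma (k + 1 + (a + 1)) ≠ 0 := (Real.Gamma_pos_of_pos (by linarith)).ne'
  have h4 : (k + a + 2 : ℝ) ≠ 0 := by linarith
  rw [h1, h2]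
  field_simp

/-- Together with `bergmanWeight_succ_succ`, this expresses all weights in the Hardy inequality
through `bergmanWeight a k` with a common denominator. -/
theorem bergmanWeight_add_two {a : ℝ} (ha : -1 < a) (k : ℕ) :
    bergmanWeight (a + 2) k
      = (a + 1) * (a + 2) / ((k + a + 2) * (k + a + 3)) * bergmanWeight a k := by
  have hk : (0 : ℝ) ≤ k := k.cast_nonneg
  have h1 := bergmanWeight_add_one ha k
  have h2 := bergmanWeight_add_one (a := a + 1) (by linarith) k
  have h4 : (k + a + 2 : ℝ) ≠ 0 := by linarith
  have h5 : (k + a + 3 : ℝ) ≠ 0 := by linarith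
  rw [show a + 1 + 1 = a + 2 by ring, show (k + (a + 1) + 2 : ℝ) = k + a + 3 by ring] at h2
  rw [div_mul_eq_mul_div, eq_div_iff (mul_ne_zero h4 h5)]
  linear_combination (k + a + 2) * h2 + (a + 2) * h1

theorem bergmanWeight_succ_succ {a : ℝ} (ha : -1 < a) (k : ℕ) :
    bergmanWeight a (k + 2)
      = (k + 1) * (k + 2) / ((k + a + 2) * (k + a + 3)) * bergmanWeight a k := by
  have hk : (0 : ℝ) ≤ k := k.cast_nonneg
  have h1 := bergmanWeight_succ ha k
  have h2 := bergmanWeight_succ ha (k + 1)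
  have h4 : (k + a + 2 : ℝ) ≠ 0 := by linarith
  have h5 : (k + a + 3 : ℝ) ≠ 0 := by linarith
  push_cast at h2
  rw [show k + 1 + 1 = k + 2 by ring] at h2
  rw [div_mul_eq_mul_div, eq_div_iff (mul_ne_zero h4 h5)]
  linear_combination (k + a + 2) * h2 + (k + 2) * h1

/-- After the reverse triangle inequality, the difference of the two sides is a perfect square over
`k (k + s)`. Equality holds for `k x = (k + s) y`; with `s = a + 2` and `k = N + 2`, `N` even, this
is the ratio of successive even coefficients of `(1 - z²) ^ (-(a + 4) / 2)`. -/
theorem sq_norm_sub_ge {s k : ℝ} (hs : 0 < s) (hk : 0 < k) (x y : ℂ) :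
    s / (k + s) * ‖x‖ ^ 2 - s / k * ‖y‖ ^ 2 ≤ ‖x - y‖ ^ 2 := by
  have h1 : (‖x‖ - ‖y‖) ^ 2 ≤ ‖x - y‖ ^ 2 := by
    rw [← sq_abs]
    exact pow_le_pow_left₀ (abs_nonneg _) (abs_norm_sub_norm_le x y) 2
  have h2 : (‖x‖ - ‖y‖) ^ 2 - (s / (k + s) * ‖x‖ ^ 2 - s / k * ‖y‖ ^ 2)
      = (k * ‖x‖ - (k + s) * ‖y‖) ^ 2 / (k * (k + s)) := by
    field_simp
    ring
  have h3 : 0 ≤ (k * ‖x‖ - (k + s) * ‖y‖) ^ 2 / (k * (k + s)) := by positivity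
  linarith

/-- The coefficients of `(1 - z²) ∑ b k z ^ k`. -/
def mulOneSubSq (b : ℕ → ℂ) : ℕ → ℂ
  | 0 => b 0
  | 1 => b 1
  | k + 2 => b (k + 2) - b k

/-- A discrete Hardy inequality. -/
theorem sum_sq_norm_mul_weight_le {a : ℝ} (ha : -1 < a) (b : ℕ → ℂ) (N : ℕ) :
    ∑ k ∈ Finset.range N, (a + 2) * (‖b k‖ ^ 2 * bergmanWeight (a + 2) k)
      ≤ ∑ k ∈ Finset.range (N + 2), (a + 1) * (‖mulOneSubSq b k‖ ^ 2 * bergmanWeight a k) := by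
  -- The induction needs the boundary terms of the telescoping sum. There are two, since
  -- `mulOneSubSq` links indices two apart and the even and odd indices telescope separately.
  suffices h : ∑ k ∈ Finset.range N, (a + 2) * (‖b k‖ ^ 2 * bergmanWeight (a + 2) k)
      + (a + 1) * ((a + 2) / (N + (a + 2)) * ‖b N‖ ^ 2 * bergmanWeight a N)
      + (a + 1) * ((a + 2) / (N + 1 + (a + 2)) * ‖b (N + 1)‖ ^ 2 * bergmanWeight a (N + 1))
      ≤ ∑ k ∈ Finset.range (N + 2), (a + 1) * (‖mulOneSubSq b k‖ ^ 2 * bergmanWeight a k) by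
    have h1 := (bergmanWeight_pos ha N).le
    have h2 := (bergmanWeight_pos ha (N + 1)).le
    have h3 : 0 ≤ a + 1 := by linarith
    have h4 : 0 ≤ a + 2 := by linarith
    have h5 : 0 ≤ (a + 1) * ((a + 2) / (N + (a + 2)) * ‖b N‖ ^ 2 * bergmanWeight a N) := by
      positivity
    have h6 : 0 ≤ (a + 1) * ((a + 2) / (N + 1 + (a + 2)) * ‖b (N + 1)‖ ^ 2
        * bergmanWeight a (N + 1)) := by positivity
    linarith
  have ha1 : 0 < a + 1 := by linarith
  have ha2 : 0 < a + 2 := by linarith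
  induction N with
  | zero =>
    have h1 := (bergmanWeight_pos ha 1).le
    rw [Finset.sum_range_zero, Finset.sum_range_succ, Finset.sum_range_one]
    simp only [mulOneSubSq]
    refine add_le_add ?_ ?_
    · rw [zero_add, Nat.cast_zero, zero_add, div_self ha2.ne', one_mul]
    · refine mul_le_mul_of_nonneg_left (mul_le_mul_of_nonneg_right ?_ h1) ha1.le
      refine mul_le_of_le_one_left (by positivity) ?_
      rw [div_le_one (by push_cast; linarith)]
      push_cast
      linarith
  | succ N ih =>
    rw [Finset.sum_range_succ, Finset.sum_range_succ _ (N + 1 + 1)]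
    have hN : (0 : ℝ) ≤ N := N.cast_nonneg
    have hw := bergmanWeight_pos ha (N + 2)
    have hterm := sq_norm_sub_ge ha2 (k := N + 2) (by positivity) (b (N + 2)) (b N)
    -- The weight of index `a + 2` is exactly what is left when the old boundary term at `N` meets
    -- the negative term of `sq_norm_sub_ge`.
    have key : (a + 2) * (‖b N‖ ^ 2 * bergmanWeight (a + 2) N)
        = (a + 1) * ((a + 2) / (N + (a + 2)) * ‖b N‖ ^ 2 * bergmanWeight a N)
          - (a + 1) * ((a + 2) / (N + 2) * ‖b N‖ ^ 2 * bergmanWeight a (N + 2)) := by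
      rw [bergmanWeight_add_two ha, bergmanWeight_succ_succ ha]
      have h4 : (N + a + 2 : ℝ) ≠ 0 := by linarith
      have h5 : (N + a + 3 : ℝ) ≠ 0 := by linarith
      have h6 : (N + (a + 2) : ℝ) ≠ 0 := by linarith
      field_simp
      ring
    have h7 := mul_le_mul_of_nonneg_left (mul_le_mul_of_nonneg_right hterm hw.le) ha1.le
    have hm : mulOneSubSq b (N + 1 + 1) = b (N + 2) - b N := rfl
    rw [hm, show N + 1 + 1 = N + 2 from rfl]
    push_cast
    rw [show (N + 1 + 1 + (a + 2) : ℝ) = N + 2 + (a + 2) by ring]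
    linarith

theorem HasDiskCoeffs.one_sub_sq_mul {b : ℕ → ℂ} {ψ : ℂ → ℂ} (h : HasDiskCoeffs b ψ) :
    HasDiskCoeffs (mulOneSubSq b) (fun z => (1 - z ^ 2) * ψ z) := by
  intro z hz
  have h1 := h z hz
  have h2 := (hasSum_nat_add_iff' 2).2 h1
  have h3 := h2.sub (h1.mul_left (z ^ 2))
  refine (hasSum_nat_add_iff' 2).1 ?_
  convert h3 using 1
  · funext k
    simp only [mulOneSubSq]
    ring
  · simp [Finset.sum_range_succ, mulOneSubSq]
    ring

theorem one_sub_sq_ne_zero {z : ℂ} (hz : z ∈ disk) : 1 - z ^ 2 ≠ 0 := by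
  intro h
  rw [mem_ball_zero_iff] at hz
  have : ‖z‖ ^ 2 = 1 := by rw [← norm_pow, ← sub_eq_zero.1 h, norm_one]
  nlinarith [norm_nonneg z]

theorem exists_hasDiskCoeffs {φ : ℂ → ℂ} (hφ : DifferentiableOn ℂ φ disk) :
    ∃ c, HasDiskCoeffs c φ := by
  refine ⟨fun k => (k.factorial : ℂ)⁻¹ * iteratedDeriv k φ 0, fun z hz => ?_⟩
  have := Complex.hasSum_taylorSeries_on_ball hφ hz
  simpa [mul_assoc, mul_comm (z ^ _)] using this

theorem HasDiskCoeffs.congr {c : ℕ → ℂ} {φ ψ : ℂ → ℂ} (h : HasDiskCoeffs c φ)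
    (hφψ : ∀ z ∈ disk, φ z = ψ z) : HasDiskCoeffs c ψ :=
  fun z hz => hφψ z hz ▸ h z hz

open MeasureTheory in
/-- Division by `1 - z²` is bounded from `A²_a` to `A²_{a+2}`. -/
theorem lintegral_bergmanDensity_div_one_sub_sq_le {a : ℝ} (ha : -1 < a) {φ : ℂ → ℂ}
    (hφ : DifferentiableOn ℂ φ disk) :
    ∫⁻ z in disk, ENNReal.ofReal (bergmanDensity (a + 2) (fun z => φ z / (1 - z ^ 2)) z)
      ≤ ENNReal.ofReal ((a + 1) / (a + 2))
        * ∫⁻ z in disk, ENNReal.ofReal (bergmanDensity a φ z) := by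
  have hψ : DifferentiableOn ℂ (fun z => φ z / (1 - z ^ 2)) disk :=
    hφ.div (by fun_prop) fun z hz => one_sub_sq_ne_zero hz
  obtain ⟨b, hb⟩ := exists_hasDiskCoeffs hψ
  have hd : HasDiskCoeffs (mulOneSubSq b) φ := hb.one_sub_sq_mul.congr fun z hz => by
    have := one_sub_sq_ne_zero hz
    field_simp
  have ha1 : 0 < a + 1 := by linarith
  have ha2 : 0 < a + 2 := by linarith
  rw [hb.lintegral_bergmanDensity (by linarith) hψ.continuousOn,
    hd.lintegral_bergmanDensity ha hφ.continuousOn, mul_left_comm]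
  refine mul_le_mul_right ?_ _
  rw [← ENNReal.tsum_mul_left]
  -- Partial sums suffice, and so neither side needs to be known finite.
  refine ENNReal.tsum_le_of_sum_range_le fun N => ?_
  refine le_trans ?_ (ENNReal.sum_le_tsum (Finset.range (N + 2)))
  have hw := fun k => (bergmanWeight_pos ha k).le
  have hw2 := fun k => (bergmanWeight_pos (a := a + 2) (by linarith) k).le
  simp only [← ENNReal.ofReal_mul (div_pos ha1 ha2).le]
  rw [← ENNReal.ofReal_sum_of_nonneg fun k _ => mul_nonneg (by positivity) (hw2 k),
    ← ENNReal.ofReal_sum_of_nonneg fun k _ =>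
      mul_nonneg (div_pos ha1 ha2).le (mul_nonneg (by positivity) (hw k))]
  refine ENNReal.ofReal_le_ofReal ?_
  have h := sum_sq_norm_mul_weight_le ha b N
  rw [← Finset.mul_sum, ← Finset.mul_sum] at h
  rw [← Finset.mul_sum, div_mul_eq_mul_div, le_div_iff₀ ha2]
  linarith

/-- The squared norm of division by `(1 - z²)ⁿ`, for unnormalized weights. -/
noncomputable def koebeProd (α : ℝ) (n : ℕ) : ℝ :=
  ∏ i ∈ Finset.range n, (α + 2 * i + 1) / (α + 2 * i + 2)

theorem koebeProd_pos {α : ℝ} (hα : -1 < α) (n : ℕ) : 0 < koebeProd α n :=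
  Finset.prod_pos fun i _ => by
    have : (0 : ℝ) ≤ i := i.cast_nonneg
    exact div_pos (by linarith) (by linarith)

-- Each division raises the weight exponent by two, so the `i`-th one contributes the constant for
-- `a = α + 2 i`.
open MeasureTheory in
theorem lintegral_bergmanDensity_div_pow_le {α : ℝ} (hα : -1 < α) {φ : ℂ → ℂ}
    (hφ : DifferentiableOn ℂ φ disk) (n : ℕ) :
    ∫⁻ z in disk, ENNReal.ofReal (bergmanDensity (α + 2 * n) (fun z => φ z / (1 - z ^ 2) ^ n) z)
      ≤ ENNReal.ofReal (koebeProd α n) * ∫⁻ z in disk, ENNReal.ofReal (bergmanDensity α φ z) := by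
  induction n with
  | zero => simp [koebeProd]
  | succ n ih =>
    have hn : (0 : ℝ) ≤ n := n.cast_nonneg
    have hd : DifferentiableOn ℂ (fun z => φ z / (1 - z ^ 2) ^ n) disk :=
      hφ.div (by fun_prop) fun z hz => pow_ne_zero _ (one_sub_sq_ne_zero hz)
    have h := lintegral_bergmanDensity_div_one_sub_sq_le (a := α + 2 * n) (by linarith) hd
    simp only [div_div, ← pow_succ] at h
    rw [show α + 2 * ((n + 1 : ℕ) : ℝ) = α + 2 * n + 2 by push_cast; ring]
    refine h.trans ((mul_le_mul_right ih _).trans_eq ?_)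
    rw [← mul_assoc, ← ENNReal.ofReal_mul (div_pos (by linarith) (by linarith)).le, koebeProd,
      koebeProd, Finset.prod_range_succ, mul_comm (Finset.prod _ _)]

/-! ### Binomial coefficients and the borderline function -/

/-- The Taylor coefficients of `(1 - s) ^ (-δ)`. -/
noncomputable def hypCoeff (δ : ℝ) (j : ℕ) : ℝ :=
  ∏ i ∈ Finset.range j, (δ + i) / (i + 1)

theorem hypCoeff_succ (δ : ℝ) (j : ℕ) :
    hypCoeff δ (j + 1) = hypCoeff δ j * ((δ + j) / (j + 1)) :=
  Finset.prod_range_succ _ _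

theorem hypCoeff_pos {δ : ℝ} (hδ : 0 < δ) (j : ℕ) : 0 < hypCoeff δ j :=
  Finset.prod_pos fun i _ => by positivity

theorem hypCoeff_monotone {δ : ℝ} (hδ : 1 ≤ δ) : Monotone (hypCoeff δ) := by
  refine monotone_nat_of_le_succ fun j => ?_
  rw [hypCoeff_succ]
  refine le_mul_of_one_le_right (hypCoeff_pos (by linarith) j).le ?_
  rw [one_le_div (by positivity)]
  linarith

/-- Compares coefficients in the derivative of `(1 - s) ^ (-δ)`, which is `δ (1 - s) ^ (-δ - 1)`. -/
theorem hypCoeff_add_one_mul (δ : ℝ) (j : ℕ) :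
    hypCoeff (δ + 1) j * δ = hypCoeff δ (j + 1) * (j + 1) := by
  induction j with
  | zero => simp [hypCoeff]
  | succ j ih =>
    rw [hypCoeff_succ, hypCoeff_succ δ (j + 1)]
    have h1 : (j + 1 : ℝ) ≠ 0 := by positivity
    have h2 : (j + 1 + 1 : ℝ) ≠ 0 := by positivity
    push_cast
    field_simp
    linear_combination (δ + 1 + j) * ih

/-- Division by `1 - s` takes partial sums of coefficients and raises `δ` by one. -/
theorem sum_hypCoeff (δ : ℝ) (j : ℕ) :
    ∑ i ∈ Finset.range (j + 1), hypCoeff δ i = hypCoeff (δ + 1) j := by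
  induction j with
  | zero => simp [hypCoeff]
  | succ j ih =>
    rw [Finset.sum_range_succ, ih, hypCoeff_succ (δ + 1)]
    have h := hypCoeff_add_one_mul δ j
    have h1 : (j + 1 : ℝ) ≠ 0 := by positivity
    field_simp
    linear_combination -h

/-- The `n`-fold derivative of `(1 - s) ^ (-δ)`, coefficientwise. It gives the quotient of the two
coefficients in `tendsto_hypCoeff_ratio` as a finite product. -/
theorem hypCoeff_add_nat_mul (δ : ℝ) (n l : ℕ) :
    hypCoeff (δ + n) l * ∏ i ∈ Finset.range n, (δ + i)
      = hypCoeff δ (l + n) * ∏ i ∈ Finset.range n, (l + i + 1 : ℝ) := by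
  induction n generalizing l with
  | zero => simp
  | succ n ih =>
    have h1 := ih (l + 1)
    have h2 := hypCoeff_add_one_mul (δ + n) l
    rw [Finset.prod_range_succ, Finset.prod_range_succ']
    rw [show l + 1 + n = l + (n + 1) by ring] at h1
    have h3 : ∏ i ∈ Finset.range n, (((l + 1 : ℕ) : ℝ) + i + 1)
        = ∏ i ∈ Finset.range n, ((l : ℝ) + ((i + 1 : ℕ) : ℝ) + 1) :=
      Finset.prod_congr rfl fun i _ => by push_cast; ring
    rw [h3] at h1
    push_cast at h1 h2 ⊢
    rw [show δ + (n + 1 : ℝ) = δ + n + 1 by ring]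
    linear_combination (l + 1 : ℝ) * h1 + (∏ i ∈ Finset.range n, (δ + i)) * h2

theorem bergmanWeight_add_two_mul {α : ℝ} (hα : -1 < α) (n k : ℕ) :
    bergmanWeight (α + 2 * n) k = (∏ i ∈ Finset.range n, (α + 2 * i + 1) * (α + 2 * i + 2)
      / ((k + (α + 2 * i) + 2) * (k + (α + 2 * i) + 3))) * bergmanWeight α k := by
  induction n with
  | zero => simp
  | succ n ih =>
    have hn : (0 : ℝ) ≤ n := n.cast_nonneg
    rw [show α + 2 * ((n + 1 : ℕ) : ℝ) = α + 2 * n + 2 by push_cast; ring,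
      bergmanWeight_add_two (by linarith), ih, Finset.prod_range_succ]
    ring

open Filter Topology in
/-- The ratio of the weighted squares of the coefficients of `(1 - z²) ^ (-(α + 2) / 2)` before and
after division by `(1 - z²)ⁿ`. -/
theorem tendsto_hypCoeff_ratio {α : ℝ} (hα : -1 < α) (n : ℕ) :
    Tendsto (fun l : ℕ => hypCoeff (α / 2 + 1 + n) l ^ 2 * bergmanWeight (α + 2 * n) (2 * (l + n))
      / (hypCoeff (α / 2 + 1) (l + n) ^ 2 * bergmanWeight α (2 * (l + n))))
      atTop (𝓝 (koebeProd α n)) := by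
  -- The ratio is a product of `n` rational functions of `l`; in each of them the two fractions tend
  -- to `1 / 2`.
  have heq : ∀ l : ℕ,
      hypCoeff (α / 2 + 1 + n) l ^ 2 * bergmanWeight (α + 2 * n) (2 * (l + n))
      / (hypCoeff (α / 2 + 1) (l + n) ^ 2 * bergmanWeight α (2 * (l + n)))
      = ∏ i ∈ Finset.range n, (α + 2 * i + 1) * (α + 2 * i + 2) / (α / 2 + 1 + i) ^ 2 *
        (((i + 1) + 1 * (l : ℝ)) / (2 * n + (α + 2 * i) + 2 + 2 * l) *
        (((i + 1) + 1 * (l : ℝ)) / (2 * n + (α + 2 * i) + 3 + 2 * l))) := by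
    intro l
    have h1 := hypCoeff_add_nat_mul (α / 2 + 1) n l
    have h2 := hypCoeff_pos (δ := α / 2 + 1) (by linarith) (l + n)
    have h3 : 0 < ∏ i ∈ Finset.range n, (α / 2 + 1 + i) := Finset.prod_pos fun i _ => by
      have : (0 : ℝ) ≤ i := i.cast_nonneg
      linarith
    have h4 := bergmanWeight_pos hα (2 * (l + n))
    have h5 : hypCoeff (α / 2 + 1 + n) l = hypCoeff (α / 2 + 1) (l + n)
        * ∏ i ∈ Finset.range n, ((l + i + 1 : ℝ) / (α / 2 + 1 + i)) := by
      rw [Finset.prod_div_distrib, ← mul_div_assoc, eq_div_iff h3.ne', h1]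
    rw [bergmanWeight_add_two_mul hα, h5, mul_pow]
    rw [show ∀ H P Q W : ℝ, H * P * (Q * W) / (H * W) = H * W * (P * Q) / (H * W) by
      intros; ring, mul_div_cancel_left₀ _ (by positivity), ← Finset.prod_pow,
      ← Finset.prod_mul_distrib]
    refine Finset.prod_congr rfl fun i _ => ?_
    push_cast
    rw [div_pow, show (2 * (l + n) + (α + 2 * i) + 2 : ℝ) = 2 * n + (α + 2 * i) + 2 + 2 * l by ring,
      show (2 * (l + n) + (α + 2 * i) + 3 : ℝ) = 2 * n + (α + 2 * i) + 3 + 2 * l by ring]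
    generalize (2 * n + (α + 2 * i) + 2 + 2 * l : ℝ) = X
    generalize (2 * n + (α + 2 * i) + 3 + 2 * l : ℝ) = Y
    generalize α / 2 + 1 + (i : ℝ) = Z
    ring
  simp only [heq, koebeProd]
  refine tendsto_finsetProd _ fun i _ => ?_
  have hl : ∀ u v : ℝ, Tendsto (fun l : ℕ => (u + 1 * (l : ℝ)) / (v + 2 * l)) atTop (𝓝 (1 / 2)) :=
    fun u v => tendsto_add_mul_div_add_mul_atTop_nhds u v 1 two_ne_zero
  have h := ((hl (i + 1) (2 * n + (α + 2 * i) + 2)).mul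
    (hl (i + 1) (2 * n + (α + 2 * i) + 3))).const_mul
      ((α + 2 * i + 1) * (α + 2 * i + 2) / (α / 2 + 1 + i) ^ 2)
  convert h using 2
  have : (0 : ℝ) ≤ i := i.cast_nonneg
  have h1 : α + 2 * i + 2 ≠ 0 := by linarith
  rw [show α / 2 + 1 + i = (α + 2 * i + 2) / 2 by ring]
  field_simp

/-- The function `(1 - z²) ^ (-(α + 2) / 2)` is not in `A²_α`. -/
theorem not_summable_hypCoeff {α : ℝ} (hα : -1 < α) :
    ¬ Summable fun j => hypCoeff (α / 2 + 1) j ^ 2 * bergmanWeight α (2 * j) := by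
  set y : ℕ → ℝ := fun j => hypCoeff (α / 2 + 1) j ^ 2 * bergmanWeight α (2 * j) with hy
  have hpos : ∀ j, 0 < y j := fun j =>
    mul_pos (pow_pos (hypCoeff_pos (by linarith) j) 2) (bergmanWeight_pos hα _)
  -- Since `j * y j` is nondecreasing, `y j ≥ y 1 / j`, and the harmonic series diverges.
  have hstep : ∀ j : ℕ, (j : ℝ) * y j ≤ (j + 1) * y (j + 1) := by
    intro j
    have hj : (0 : ℝ) ≤ j := j.cast_nonneg
    have h : y (j + 1) = (α / 2 + 1 + j) * (j + 1 / 2) / ((j + 1) * (j + α / 2 + 3 / 2)) * y j := by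
      simp only [hy]
      rw [hypCoeff_succ, show 2 * (j + 1) = 2 * j + 2 by ring, bergmanWeight_succ_succ hα]
      push_cast
      have h1 : (2 * j + α + 2 : ℝ) = 2 * (α / 2 + 1 + j) := by ring
      have h2 : (2 * j + α + 3 : ℝ) = 2 * (j + α / 2 + 3 / 2) := by ring
      have h3 : (α / 2 + 1 + j : ℝ) ≠ 0 := by linarith
      have h4 : (j + α / 2 + 3 / 2 : ℝ) ≠ 0 := by linarith
      rw [h1, h2]
      field_simp
    have h4 : (0 : ℝ) < j + α / 2 + 3 / 2 := by linarith
    have h5 : ((j : ℝ) + 1) * y (j + 1)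
        = (α / 2 + 1 + j) * (j + 1 / 2) / (j + α / 2 + 3 / 2) * y j := by
      rw [h]
      field_simp
    rw [h5]
    refine mul_le_mul_of_nonneg_right ?_ (hpos j).le
    rw [le_div_iff₀ h4]
    nlinarith
  have hlow : ∀ j : ℕ, y 1 ≤ ((j + 1 : ℕ) : ℝ) * y (j + 1) := by
    intro j
    induction j with
    | zero => simp
    | succ j ih =>
      refine ih.trans ((hstep (j + 1)).trans_eq ?_)
      push_cast
      ring
  intro hs
  have h1 : Summable fun j : ℕ => y 1 * (1 / ((j + 1 : ℕ) : ℝ)) := by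
    refine Summable.of_nonneg_of_le (fun j => mul_nonneg (hpos 1).le (by positivity)) (fun j => ?_)
      ((summable_nat_add_iff 1).2 hs)
    rw [mul_one_div, div_le_iff₀ (by positivity), mul_comm]
    exact hlow j
  rw [summable_mul_left_iff (hpos 1).ne'] at h1
  exact Real.not_summable_one_div_natCast
    ((summable_nat_add_iff (f := fun j : ℕ => 1 / (j : ℝ)) 1).1 h1)

/-! ### Power series operations and the test functions -/

theorem HasDiskCoeffs.div_one_sub {c : ℕ → ℂ} {f : ℂ → ℂ} (h : HasDiskCoeffs c f) :
    HasDiskCoeffs (fun j => ∑ i ∈ Finset.range (j + 1), c i) (fun s => f s / (1 - s)) := by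
  intro s hs
  have h1 := h s hs
  rw [mem_ball_zero_iff] at hs
  have h2 := hasSum_geometric_of_norm_lt_one hs
  have h3 := (summable_norm_sum_mul_range_of_summable_norm h1.summable.norm
    h2.summable.norm).of_norm.hasSum
  rw [← tsum_mul_tsum_eq_tsum_sum_range_of_summable_norm h1.summable.norm h2.summable.norm,
    h1.tsum_eq, h2.tsum_eq] at h3
  convert! h3 using 1
  funext j
  rw [Finset.sum_mul]
  refine Finset.sum_congr rfl fun i hi => ?_
  rw [mul_assoc, ← pow_add, Nat.add_sub_cancel' (Nat.lt_succ_iff.1 (Finset.mem_range.1 hi))]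

theorem HasDiskCoeffs.pow_mul {c : ℕ → ℂ} {f : ℂ → ℂ} (h : HasDiskCoeffs c f) (k : ℕ) :
    HasDiskCoeffs (fun j => if k ≤ j then c (j - k) else 0) (fun s => s ^ k * f s) := by
  intro s hs
  rw [← (add_left_injective k).hasSum_iff]
  · convert! (h s hs).mul_left (s ^ k) using 1
    funext j
    simp only [Function.comp_apply, if_pos (Nat.le_add_left k j), Nat.add_sub_cancel]
    ring
  · intro j hj
    dsimp only
    rw [if_neg, zero_mul]
    exact fun hkj => hj ⟨j - k, Nat.sub_add_cancel hkj⟩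

theorem HasDiskCoeffs.finsetSum_mul {S : Finset ℕ} {w : ℕ → ℂ} {c : ℕ → ℕ → ℂ} {f : ℕ → ℂ → ℂ}
    (h : ∀ m ∈ S, HasDiskCoeffs (c m) (f m)) :
    HasDiskCoeffs (fun j => ∑ m ∈ S, w m * c m j) (fun s => ∑ m ∈ S, w m * f m s) := by
  intro s hs
  have := hasSum_sum fun m hm => (h m hm s hs).mul_left (w m)
  simpa only [Finset.sum_mul, mul_assoc] using this

theorem sq_mem_disk {z : ℂ} (hz : z ∈ disk) : z ^ 2 ∈ disk := by
  rw [mem_ball_zero_iff] at hz ⊢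
  rw [norm_pow]
  nlinarith [norm_nonneg z]

theorem HasDiskCoeffs.comp_sq {c : ℕ → ℂ} {f : ℂ → ℂ} (h : HasDiskCoeffs c f) :
    HasDiskCoeffs (fun k => if Even k then c (k / 2) else 0) (fun z => f (z ^ 2)) := by
  intro z hz
  rw [← (mul_right_injective₀ (two_ne_zero (α := ℕ))).hasSum_iff]
  · convert! h _ (sq_mem_disk hz) using 1
    funext j
    simp [← _root_.pow_mul]
  · intro j hj
    dsimp only
    rw [if_neg, zero_mul]
    rintro ⟨k, rfl⟩
    exact hj ⟨k, two_mul k⟩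

open MeasureTheory in
theorem HasDiskCoeffs.lintegral_bergmanDensity_comp_sq {a : ℝ} (ha : -1 < a) {c : ℕ → ℂ}
    {f : ℂ → ℂ} (hf : ContinuousOn f disk) (h : HasDiskCoeffs c f) :
    ∫⁻ z in disk, ENNReal.ofReal (bergmanDensity a (fun z => f (z ^ 2)) z)
      = ENNReal.ofReal Real.pi * ∑' j, ENNReal.ofReal (‖c j‖ ^ 2 * bergmanWeight a (2 * j)) := by
  have hfc : ContinuousOn (fun z => f (z ^ 2)) disk :=
    hf.comp (f := fun z : ℂ => z ^ 2) (by fun_prop) fun z hz => sq_mem_disk hz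
  rw [h.comp_sq.lintegral_bergmanDensity ha hfc]
  congr 1
  rw [← (mul_right_injective₀ (two_ne_zero (α := ℕ))).tsum_eq]
  · simp
  · intro k hk
    by_contra hk'
    refine hk ?_
    dsimp only
    rw [if_neg]
    · simp
    · rintro ⟨j, rfl⟩
      exact hk' ⟨j, two_mul j⟩

/-- The Taylor polynomial of `(1 - s) ^ (-δ)`. -/
noncomputable def hypPoly (δ : ℝ) (N : ℕ) (s : ℂ) : ℂ :=
  ∑ j ∈ Finset.range (N + 1), (hypCoeff δ j : ℂ) * s ^ j

theorem differentiable_hypPoly (δ : ℝ) (N : ℕ) : Differentiable ℂ (hypPoly δ N) := by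
  unfold hypPoly
  fun_prop

theorem hasDiskCoeffs_hypPoly (δ : ℝ) (N : ℕ) :
    HasDiskCoeffs (fun j => if j ≤ N then (hypCoeff δ j : ℂ) else 0) (hypPoly δ N) := by
  intro s _
  have h : ∀ j ∉ Finset.range (N + 1), (if j ≤ N then (hypCoeff δ j : ℂ) else 0) * s ^ j = 0 := by
    intro j hj
    rw [if_neg (by simpa [Nat.lt_succ_iff] using hj), zero_mul]
  convert! hasSum_sum_of_ne_finset_zero (L := SummationFilter.unconditional ℕ) h using 1
  refine Finset.sum_congr rfl fun j hj => ?_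
  rw [if_pos (Nat.lt_succ_iff.1 (Finset.mem_range.1 hj))]

/-- Division by `1 - s` takes partial sums, so a coefficient depends only on those of no larger
index: truncation at `N` is invisible up to `N`. -/
theorem exists_hasDiskCoeffs_hypPoly_div (δ : ℝ) (N n : ℕ) :
    ∃ c, HasDiskCoeffs c (fun s => hypPoly δ N s / (1 - s) ^ n) ∧
      ∀ j ≤ N, c j = (hypCoeff (δ + n) j : ℂ) := by
  induction n with
  | zero =>
    refine ⟨_, (hasDiskCoeffs_hypPoly δ N).congr fun s _ => by simp, fun j hj => ?_⟩
    simp [hj]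
  | succ n ih =>
    obtain ⟨c, hc, hcN⟩ := ih
    refine ⟨_, hc.div_one_sub.congr fun s _ => by rw [div_div, ← pow_succ], fun j hj => ?_⟩
    rw [Finset.sum_congr rfl fun i hi => hcN i
      ((Nat.lt_succ_iff.1 (Finset.mem_range.1 hi)).trans hj), ← Complex.ofReal_sum, sum_hypCoeff]
    push_cast
    rw [add_assoc]

open MeasureTheory in
/-- Lower bound for the norm of the product of the test function with `g`. -/
theorem sum_le_lintegral_bergmanDensity_mul {α : ℝ} (hα : -1 < α) {n : ℕ} (hn : 1 ≤ n)
    {S : Finset ℕ} {w : ℕ → ℝ} {e f : ℕ → ℕ} (hw : ∀ m ∈ S, 0 ≤ w m) (hf : ∀ m ∈ S, f m ≤ n)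
    (hef : ∀ m ∈ S, w m ≠ 0 → n + e m = 2 * f m) {g : ℂ → ℂ}
    (hg : ∀ z ∈ disk, g z = -(∑ m ∈ S, (w m : ℂ) * z ^ e m) / (1 - z ^ 2) ^ n) (M : ℕ) :
    ENNReal.ofReal Real.pi * ∑ l ∈ Finset.range (M + 1), ENNReal.ofReal ((∑ m ∈ S, w m) ^ 2 *
        (hypCoeff (α / 2 + 1 + n) l ^ 2 * bergmanWeight (α + 2 * n) (2 * (l + n))))
      ≤ ∫⁻ z in disk, ENNReal.ofReal (bergmanDensity (α + 2 * n)
        (fun z => g z * hypPoly (α / 2 + 1) (M + n) (z ^ 2)) z) := by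
  obtain ⟨c, hc, hcN⟩ := exists_hasDiskCoeffs_hypPoly_div (α / 2 + 1) (M + n) n
  have hn1 : (1 : ℝ) ≤ n := by exact_mod_cast hn
  have hβ : -1 < α + 2 * n := by linarith
  have h := HasDiskCoeffs.finsetSum_mul (w := fun m => (w m : ℂ))
    fun m (_ : m ∈ S) => hc.pow_mul (f m)
  have hne : ∀ s ∈ disk, (1 : ℂ) - s ≠ 0 := by
    intro s hs h
    rw [mem_ball_zero_iff, ← sub_eq_zero.1 h] at hs
    simp at hs
  have hcont : ContinuousOn (fun s : ℂ => ∑ m ∈ S, (w m : ℂ) *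
      (s ^ f m * (hypPoly (α / 2 + 1) (M + n) s / (1 - s) ^ n))) disk := by
    refine continuousOn_finsetSum _ fun m _ => continuousOn_const.mul ((continuousOn_pow _).mul ?_)
    exact (differentiable_hypPoly _ _).continuous.continuousOn.div (by fun_prop)
      fun s hs => pow_ne_zero _ (hne s hs)
  refine le_trans ?_ ((h.lintegral_bergmanDensity_comp_sq hβ hcont).symm.le.trans
    (setLIntegral_mono' measurableSet_ball fun z hz => ENNReal.ofReal_le_ofReal ?_))
  -- Only the coefficients of index `l + n` with `l ≤ M` are kept; these are unaffected by the
  -- truncation.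
  · refine mul_le_mul_right (le_trans ?_ (ENNReal.sum_le_tsum
      ((Finset.range (M + 1)).map (addRightEmbedding n)))) _
    rw [Finset.sum_map]
    refine Finset.sum_le_sum fun l hl => ENNReal.ofReal_le_ofReal ?_
    rw [Finset.mem_range] at hl
    simp only [addRightEmbedding_apply]
    rw [← mul_assoc]
    refine mul_le_mul_of_nonneg_right ?_ (bergmanWeight_pos hβ _).le
    rw [← mul_pow]
    have h1 : ∑ m ∈ S, (w m : ℂ) * (if f m ≤ l + n then c (l + n - f m) else 0)
        = ((∑ m ∈ S, w m * hypCoeff (α / 2 + 1 + n) (l + n - f m) : ℝ) : ℂ) := by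
      push_cast
      refine Finset.sum_congr rfl fun m hm => ?_
      rw [if_pos ((hf m hm).trans (Nat.le_add_left _ _)), hcN _ (by omega)]
    have h2 : ∀ j, 0 < hypCoeff (α / 2 + 1 + n) j := hypCoeff_pos (by linarith)
    rw [h1, Complex.norm_real, Real.norm_eq_abs, sq_abs, Finset.sum_mul]
    refine pow_le_pow_left₀ (Finset.sum_nonneg fun m hm => mul_nonneg (hw m hm) (h2 _).le)
      (Finset.sum_le_sum fun m hm => mul_le_mul_of_nonneg_left ?_ (hw m hm)) 2
    -- The shifts satisfy `f m ≤ n`, so every term is at least the one with `f m = n`.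
    refine hypCoeff_monotone (by linarith) ?_
    have := hf m hm
    omega
  · have hz' := hz
    rw [mem_ball_zero_iff] at hz'
    refine mul_le_mul_of_nonneg_right ?_
      (Real.rpow_nonneg (by nlinarith [norm_nonneg z]) _)
    -- Multiplying by `z ^ n`, which can only decrease the modulus, makes the numerator a polynomial
    -- in `z²`.
    have h3 : ∑ m ∈ S, (w m : ℂ) * ((z ^ 2) ^ f m * (hypPoly (α / 2 + 1) (M + n) (z ^ 2)
        / (1 - z ^ 2) ^ n)) = -(z ^ n * (g z * hypPoly (α / 2 + 1) (M + n) (z ^ 2))) := by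
      have h4 : ∑ m ∈ S, (w m : ℂ) * ((z ^ 2) ^ f m * (hypPoly (α / 2 + 1) (M + n) (z ^ 2)
        / (1 - z ^ 2) ^ n)) = ∑ m ∈ S, (w m : ℂ) * z ^ e m * (z ^ n *
          (hypPoly (α / 2 + 1) (M + n) (z ^ 2) / (1 - z ^ 2) ^ n)) := by
        refine Finset.sum_congr rfl fun m hm => ?_
        by_cases hm0 : w m = 0
        · simp [hm0]
        · rw [← pow_mul, ← hef m hm hm0, pow_add]
          ring
      rw [h4, ← Finset.sum_mul, hg z hz]
      ring
    dsimp only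
    rw [h3, norm_neg, norm_mul, norm_pow]
    refine pow_le_pow_left₀ (by positivity) ?_ 2
    exact mul_le_of_le_one_left (norm_nonneg _) (pow_le_one₀ (norm_nonneg _) hz'.le)

open MeasureTheory in
theorem lintegral_bergmanDensity_hypPoly {α : ℝ} (hα : -1 < α) (δ : ℝ) (N : ℕ) :
    ∫⁻ z in disk, ENNReal.ofReal (bergmanDensity α (fun z => hypPoly δ N (z ^ 2)) z)
      = ENNReal.ofReal (Real.pi * ∑ j ∈ Finset.range (N + 1),
        hypCoeff δ j ^ 2 * bergmanWeight α (2 * j)) := by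
  have hw := fun k => (bergmanWeight_pos hα k).le
  rw [(hasDiskCoeffs_hypPoly δ N).lintegral_bergmanDensity_comp_sq hα
    (differentiable_hypPoly δ N).continuous.continuousOn, ENNReal.ofReal_mul Real.pi_pos.le,
    ENNReal.ofReal_sum_of_nonneg fun j _ => mul_nonneg (sq_nonneg _) (hw _),
    tsum_eq_sum (s := Finset.range (N + 1))]
  · congr 1
    refine Finset.sum_congr rfl fun j hj => ?_
    rw [if_pos (Nat.lt_succ_iff.1 (Finset.mem_range.1 hj)), Complex.norm_real, Real.norm_eq_abs,
      sq_abs]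
  · intro j hj
    rw [if_neg (by simpa [Nat.lt_succ_iff] using hj)]
    simp

open Filter Topology in
theorem exists_sum_hypCoeff_le {α : ℝ} (hα : -1 < α) (n : ℕ) {κ : ℝ}
    (hκ : κ < koebeProd α n) :
    ∃ M : ℕ, κ * ∑ j ∈ Finset.range (M + n + 1),
        hypCoeff (α / 2 + 1) j ^ 2 * bergmanWeight α (2 * j)
      ≤ ∑ l ∈ Finset.range (M + 1), hypCoeff (α / 2 + 1 + n) l ^ 2
          * bergmanWeight (α + 2 * n) (2 * (l + n)) := by
  set y : ℕ → ℝ := fun j => hypCoeff (α / 2 + 1) j ^ 2 * bergmanWeight α (2 * j) with hy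
  set x : ℕ → ℝ := fun l => hypCoeff (α / 2 + 1 + n) l ^ 2
          * bergmanWeight (α + 2 * n) (2 * (l + n)) with hx
  have hn : (0 : ℝ) ≤ n := n.cast_nonneg
  have hy0 : ∀ j, 0 < y j := fun j =>
    mul_pos (pow_pos (hypCoeff_pos (by linarith) j) 2) (bergmanWeight_pos hα _)
  have hx0 : ∀ j, 0 < x j := fun j =>
    mul_pos (pow_pos (hypCoeff_pos (by linarith) j) 2) (bergmanWeight_pos (by linarith) _)
  -- Termwise comparison with `κ'` holds only from index `L` on. The slack `κ' - κ` times the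
  -- divergent sum of `y` pays for the finitely many earlier terms.
  obtain ⟨κ', hκκ', hκ'⟩ := exists_between hκ
  obtain ⟨L, hL⟩ := eventually_atTop.1 ((tendsto_hypCoeff_ratio hα n).eventually
    (eventually_ge_nhds hκ'))
  have hyT : Tendsto (fun N => ∑ j ∈ Finset.range N, y j) atTop atTop :=
    (not_summable_iff_tendsto_nat_atTop_of_nonneg fun j => (hy0 j).le).1
      (not_summable_hypCoeff hα)
  obtain ⟨N, hN⟩ := eventually_atTop.1 (hyT.eventually_ge_atTop
    (κ' * ∑ j ∈ Finset.range (L + n), y j / (κ' - κ)))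
  have hmain : ∀ M, κ' * ∑ j ∈ Finset.range (L + M + n), y j
      - κ' * ∑ j ∈ Finset.range (L + n), y j ≤ ∑ l ∈ Finset.range (L + M), x l := by
    intro M
    induction M with
    | zero => simpa using Finset.sum_nonneg fun l _ => (hx0 l).le
    | succ M ih =>
      rw [← add_assoc, Finset.sum_range_succ, show L + M + 1 + n = L + M + n + 1 by ring,
        Finset.sum_range_succ]
      have h := hL (L + M) (Nat.le_add_right _ _)
      rw [le_div_iff₀ (hy0 (L + M + n))] at h
      change κ' * y (L + M + n) ≤ x (L + M) at h
      linarith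
  refine ⟨L + N, ?_⟩
  have h1 := hmain (N + 1)
  have h2 := hN (L + N + n + 1) (by omega)
  rw [← Finset.sum_div, ← mul_div_assoc, div_le_iff₀ (by linarith)] at h2
  rw [show L + (N + 1) + n = L + N + n + 1 by ring, ← add_assoc] at h1
  linarith

/-! ### The multiplier norm -/

theorem bergmanDensity_nonneg (a : ℝ) (φ : ℂ → ℂ) {z : ℂ} (hz : z ∈ disk) :
    0 ≤ bergmanDensity a φ z := by
  rw [mem_ball_zero_iff] at hz
  exact mul_nonneg (sq_nonneg _) (Real.rpow_nonneg (by nlinarith [norm_nonneg z]) _)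

open MeasureTheory in
theorem aestronglyMeasurable_bergmanDensity (a : ℝ) {φ : ℂ → ℂ} (hφ : DifferentiableOn ℂ φ disk) :
    AEStronglyMeasurable (bergmanDensity a φ) (volume.restrict disk) :=
  (continuousOn_bergmanDensity a hφ.continuousOn).aestronglyMeasurable measurableSet_ball

open MeasureTheory in
theorem memBergman_iff {a : ℝ} {φ : ℂ → ℂ} : MemBergman a φ ↔ DifferentiableOn ℂ φ disk ∧
    ∫⁻ z in disk, ENNReal.ofReal (bergmanDensity a φ z) < ⊤ := by
  refine and_congr_right fun hφ => ⟨fun h => h.lintegral_lt_top, fun h => ?_⟩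
  refine ⟨aestronglyMeasurable_bergmanDensity a hφ, ?_⟩
  rwa [hasFiniteIntegral_iff_ofReal]
  exact (ae_restrict_iff' measurableSet_ball).2
    (Filter.Eventually.of_forall fun z hz => bergmanDensity_nonneg a φ hz)

open MeasureTheory in
theorem bergmanNorm_eq {a : ℝ} {φ : ℂ → ℂ} (hφ : DifferentiableOn ℂ φ disk) :
    bergmanNorm a φ = √((a + 1) *
      ((∫⁻ z in disk, ENNReal.ofReal (bergmanDensity a φ z)).toReal / Real.pi)) := by
  rw [bergmanNorm, integral_eq_lintegral_of_nonneg_ae _ (aestronglyMeasurable_bergmanDensity a hφ)]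
  exact (ae_restrict_iff' measurableSet_ball).2
    (Filter.Eventually.of_forall fun z hz => bergmanDensity_nonneg a φ hz)

/-- Converts a constant `c` for unnormalized integrals into one for norms; the normalizations
contribute `(β + 1) / (α + 1)`. -/
theorem sqrt_mul_sqrt_norm {α β c J : ℝ} (hα : -1 < α) (hβ : -1 < β) (hc : 0 ≤ c) :
    √(c * ((β + 1) / (α + 1))) * √((α + 1) * (J / Real.pi))
      = √((β + 1) * (c * J / Real.pi)) := by
  have h1 : 0 < α + 1 := by linarith
  have h2 : 0 < β + 1 := by linarith
  rw [← Real.sqrt_mul (by positivity)]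
  congr 1
  field_simp

open MeasureTheory in
theorem lintegral_bergmanDensity_mul_le {α : ℝ} (hα : -1 < α) {n : ℕ} {A : ℝ} {g φ : ℂ → ℂ}
    (hg : ∀ z ∈ disk, ‖g z‖ ≤ A / ‖1 - z ^ 2‖ ^ n) (hφ : DifferentiableOn ℂ φ disk) :
    ∫⁻ z in disk, ENNReal.ofReal (bergmanDensity (α + 2 * n) (fun z => g z * φ z) z)
      ≤ ENNReal.ofReal (A ^ 2 * koebeProd α n)
        * ∫⁻ z in disk, ENNReal.ofReal (bergmanDensity α φ z) := by
  have h := lintegral_bergmanDensity_div_pow_le hα hφ n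
  rw [ENNReal.ofReal_mul (sq_nonneg A), mul_assoc]
  refine le_trans ?_ (mul_le_mul_right h _)
  rw [← lintegral_const_mul' _ _ ENNReal.ofReal_ne_top]
  refine setLIntegral_mono' measurableSet_ball fun z hz => ?_
  rw [← ENNReal.ofReal_mul (sq_nonneg A)]
  refine ENNReal.ofReal_le_ofReal ?_
  have hz' := hz
  rw [mem_ball_zero_iff] at hz'
  unfold bergmanDensity
  rw [← mul_assoc]
  refine mul_le_mul_of_nonneg_right ?_ (Real.rpow_nonneg (by nlinarith [norm_nonneg z]) _)
  rw [← mul_pow, norm_mul, norm_div, norm_pow]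
  refine pow_le_pow_left₀ (by positivity) ?_ 2
  calc ‖g z‖ * ‖φ z‖ ≤ A / ‖1 - z ^ 2‖ ^ n * ‖φ z‖ :=
        mul_le_mul_of_nonneg_right (hg z hz) (norm_nonneg _)
    _ = A * (‖φ z‖ / ‖1 - z ^ 2‖ ^ n) := by ring

open MeasureTheory in
/-- The multiplier norm of a function of the form `-∑ w m z ^ e m / (1 - z²)ⁿ`, where the weights
are nonnegative and the exponents have the same parity as `n` and are at most `n`. -/
theorem multiplierNorm_of_eq_sum_div {α : ℝ} (hα : -1 < α) {n : ℕ} (hn : 1 ≤ n)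
    {S : Finset ℕ} {w : ℕ → ℝ} {e f : ℕ → ℕ} (hw : ∀ m ∈ S, 0 ≤ w m) (hf : ∀ m ∈ S, f m ≤ n)
    (hef : ∀ m ∈ S, w m ≠ 0 → n + e m = 2 * f m) (hA : 0 < ∑ m ∈ S, w m) {g : ℂ → ℂ}
    (hg : ∀ z ∈ disk, g z = -(∑ m ∈ S, (w m : ℂ) * z ^ e m) / (1 - z ^ 2) ^ n) :
    IsMultiplier α (α + 2 * n) g ∧ multiplierNorm α (α + 2 * n) g
      = √((∑ m ∈ S, w m) ^ 2 * koebeProd α n * ((α + 2 * n + 1) / (α + 1))) := by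
  set A := ∑ m ∈ S, w m with hAdef
  have hn0 : (0 : ℝ) ≤ n := n.cast_nonneg
  have hβ : -1 < α + 2 * n := by linarith
  have hα1 : 0 < α + 1 := by linarith
  have hβ1 : 0 < α + 2 * n + 1 := by linarith
  have hK := koebeProd_pos hα n
  have hgd : DifferentiableOn ℂ g disk := by
    refine DifferentiableOn.congr (DifferentiableOn.div (by fun_prop) (by fun_prop)
      fun z hz => pow_ne_zero n (one_sub_sq_ne_zero hz)) hg
  have hbound : ∀ z ∈ disk, ‖g z‖ ≤ A / ‖1 - z ^ 2‖ ^ n := by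
    intro z hz
    rw [hg z hz, norm_div, norm_neg, norm_pow]
    refine div_le_div_of_nonneg_right ?_ (by positivity)
    refine (norm_sum_le _ _).trans (Finset.sum_le_sum fun m hm => ?_)
    rw [mem_ball_zero_iff] at hz
    rw [norm_mul, norm_pow, Complex.norm_real, Real.norm_eq_abs, abs_of_nonneg (hw m hm)]
    exact mul_le_of_le_one_right (hw m hm) (pow_le_one₀ (norm_nonneg _) hz.le)
  have hmem : ∀ φ : ℂ → ℂ, MemBergman α φ → MemBergman (α + 2 * n) (fun z => g z * φ z) := by
    intro φ hφ
    rw [memBergman_iff] at hφ ⊢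
    exact ⟨hgd.mul hφ.1, (lintegral_bergmanDensity_mul_le hα hbound hφ.1).trans_lt
      (ENNReal.mul_lt_top ENNReal.ofReal_lt_top hφ.2)⟩
  have hle : ∀ φ : ℂ → ℂ, MemBergman α φ → bergmanNorm (α + 2 * n) (fun z => g z * φ z)
      ≤ √(A ^ 2 * koebeProd α n * ((α + 2 * n + 1) / (α + 1))) * bergmanNorm α φ := by
    intro φ hφ
    rw [memBergman_iff] at hφ
    have hgφd : DifferentiableOn ℂ (fun z => g z * φ z) disk := hgd.mul hφ.1
    rw [bergmanNorm_eq hgφd, bergmanNorm_eq hφ.1,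
      sqrt_mul_sqrt_norm hα hβ (by positivity)]
    refine Real.sqrt_le_sqrt (mul_le_mul_of_nonneg_left (div_le_div_of_nonneg_right ?_
      Real.pi_pos.le) hβ1.le)
    have h := ENNReal.toReal_mono (ENNReal.mul_ne_top ENNReal.ofReal_ne_top hφ.2.ne)
      (lintegral_bergmanDensity_mul_le hα hbound hφ.1)
    rwa [ENNReal.toReal_mul, ENNReal.toReal_ofReal (by positivity)] at h
  have hgt : ∀ v < √(A ^ 2 * koebeProd α n * ((α + 2 * n + 1) / (α + 1))), ∃ φ : ℂ → ℂ,
      MemBergman α φ ∧ (∃ z ∈ disk, φ z ≠ 0) ∧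
        v < bergmanNorm (α + 2 * n) (fun z => g z * φ z) / bergmanNorm α φ := by
    intro v hv
    -- The number `v` may be negative, so its positive part is squared.
    have hmax : max v 0 ^ 2 < A ^ 2 * koebeProd α n * ((α + 2 * n + 1) / (α + 1)) :=
      (Real.lt_sqrt (le_max_right _ _)).1 (max_lt hv (by positivity))
    have hR : 0 < A ^ 2 * ((α + 2 * n + 1) / (α + 1)) := by positivity
    -- A `κ` below the sharp constant that still beats `v`; the test polynomial is then chosen for
    -- this `κ`.
    obtain ⟨κ, hκ1, hκ2⟩ := exists_between (show max v 0 ^ 2 / (A ^ 2 * ((α + 2 * n + 1) / (α + 1)))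
      < koebeProd α n by rw [div_lt_iff₀ hR]; linarith)
    have hκ0 : 0 ≤ κ := (by positivity : (0 : ℝ) ≤ _).trans hκ1.le
    rw [div_lt_iff₀ hR] at hκ1
    obtain ⟨M, hM⟩ := exists_sum_hypCoeff_le hα n hκ2
    have hδ : 0 < α / 2 + 1 := by linarith
    have hI := lintegral_bergmanDensity_hypPoly hα (α / 2 + 1) (M + n)
    have hlow := sum_le_lintegral_bergmanDensity_mul hα hn hw hf hef hg M
    have hd : DifferentiableOn ℂ (fun z => hypPoly (α / 2 + 1) (M + n) (z ^ 2)) disk :=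
      ((differentiable_hypPoly _ _).comp (differentiable_pow 2)).differentiableOn
    have hφ : MemBergman α (fun z => hypPoly (α / 2 + 1) (M + n) (z ^ 2)) :=
      memBergman_iff.2 ⟨hd, by rw [hI]; exact ENNReal.ofReal_lt_top⟩
    have hy : ∀ j, 0 < hypCoeff (α / 2 + 1) j ^ 2 * bergmanWeight α (2 * j) := fun j =>
      mul_pos (pow_pos (hypCoeff_pos hδ j) 2) (bergmanWeight_pos hα _)
    have hY : 0 < ∑ j ∈ Finset.range (M + n + 1),
        hypCoeff (α / 2 + 1) j ^ 2 * bergmanWeight α (2 * j) :=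
      Finset.sum_pos (fun j _ => hy j) ⟨0, by simp⟩
    have hgφd : DifferentiableOn ℂ (fun z => g z * hypPoly (α / 2 + 1) (M + n) (z ^ 2)) disk :=
      hgd.mul hd
    refine ⟨_, hφ, ⟨0, by simp, ?_⟩, ?_⟩
    · simp [hypPoly, Finset.sum_range_succ', hypCoeff]
    rw [bergmanNorm_eq hd, bergmanNorm_eq hgφd, hI, ENNReal.toReal_ofReal (by positivity)]
    rw [lt_div_iff₀ (by positivity)]
    have hv2 : v < √(A ^ 2 * κ * ((α + 2 * n + 1) / (α + 1))) :=
      (le_max_left v 0).trans_lt ((Real.lt_sqrt (le_max_right _ _)).2 (by linarith))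
    refine (mul_lt_mul_of_pos_right hv2 (by positivity)).trans_le ?_
    rw [sqrt_mul_sqrt_norm hα hβ (by positivity)]
    refine Real.sqrt_le_sqrt (mul_le_mul_of_nonneg_left (div_le_div_of_nonneg_right ?_
      Real.pi_pos.le) hβ1.le)
    have hx : ∀ l, 0 ≤ hypCoeff (α / 2 + 1 + n) l ^ 2
        * bergmanWeight (α + 2 * n) (2 * (l + n)) := fun l =>
      mul_nonneg (sq_nonneg _) (bergmanWeight_pos hβ _).le
    have h := ENNReal.toReal_mono (memBergman_iff.1 (hmem _ hφ)).2.ne hlow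
    rw [← ENNReal.ofReal_sum_of_nonneg fun l _ => mul_nonneg (sq_nonneg _) (hx l),
      ← ENNReal.ofReal_mul Real.pi_pos.le, ENNReal.toReal_ofReal (mul_nonneg Real.pi_pos.le
        (Finset.sum_nonneg fun l _ => mul_nonneg (sq_nonneg _) (hx l))), ← Finset.mul_sum] at h
    refine le_trans ?_ h
    have h2 := mul_le_mul_of_nonneg_left hM (by positivity : 0 ≤ Real.pi * A ^ 2)
    linarith
  refine ⟨⟨hgd, hmem, _, hle⟩, ?_⟩
  refine csSup_eq_of_forall_le_of_forall_lt_exists_gt ?_ ?_ ?_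
  -- The supremum is over a nonempty set: any negative `v` produces a test function.
  · obtain ⟨φ, h1, h2, -⟩ := hgt _ (neg_one_lt_zero.trans_le (Real.sqrt_nonneg _))
    exact ⟨_, φ, h1, h2, rfl⟩
  · rintro _ ⟨φ, hφ, -, rfl⟩
    exact div_le_of_le_mul₀ (Real.sqrt_nonneg _) (Real.sqrt_nonneg _) (hle φ hφ)
  · intro v hv
    obtain ⟨φ, h1, h2, h3⟩ := hgt v hv
    exact ⟨_, ⟨φ, h1, h2, rfl⟩, h3⟩

/-! ### Derivatives of `log (1 - z w)` -/

theorem one_sub_mul_ne_zero {z w : ℂ} (hz : z ∈ disk) (hw : w ∈ disk) : 1 - z * w ≠ 0 := by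
  intro h
  rw [mem_ball_zero_iff] at hz hw
  have : ‖z‖ * ‖w‖ = 1 := by rw [← norm_mul, ← sub_eq_zero.1 h, norm_one]
  nlinarith [norm_nonneg z, norm_nonneg w]

theorem hasDerivAt_pow_mul_div_one_sub_mul {z w : ℂ} (hz : z ∈ disk) (hw : w ∈ disk)
    (c : ℂ) (m k N : ℕ) :
    HasDerivAt (fun ζ => c * ζ ^ m * w ^ k / (1 - ζ * w) ^ N)
      ((c * (m * z ^ (m - 1)) * w ^ k * (1 - z * w) + N * c * z ^ m * w ^ (k + 1))
        / (1 - z * w) ^ (N + 1)) z := by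
  have h0 := one_sub_mul_ne_zero hz hw
  have h1 : HasDerivAt (fun ζ : ℂ => 1 - ζ * w) (-w) z := by
    simpa using ((hasDerivAt_id z).mul_const w).const_sub 1
  have h2 := (((hasDerivAt_pow m z).const_mul c).mul_const (w ^ k)).div (h1.pow N)
    (pow_ne_zero N h0)
  refine h2.congr_deriv ?_
  simp only [Pi.pow_apply]
  rw [div_eq_div_iff (pow_ne_zero _ (pow_ne_zero _ h0)) (pow_ne_zero _ h0)]
  rcases N with _ | N
  · simp
  · simp only [Nat.add_sub_cancel]
    push_cast
    ring

theorem grunskyLog_koebe {z w : ℂ} (hz : z ∈ disk) (hw : w ∈ disk) :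
    grunskyLog koebe z w = Complex.log (1 - z * w) := by
  have h : ∃ F, IsGrunskyLog koebe F := ⟨_, isGrunskyLog_koebe⟩
  have hF : IsGrunskyLog koebe (grunskyLog koebe) := by
    unfold grunskyLog
    rw [dif_pos h]
    exact h.choose_spec
  exact hF.unique isGrunskyLog_koebe hz hw

theorem disk_mem_nhds {z : ℂ} (hz : z ∈ disk) : disk ∈ nhds z := Metric.isOpen_ball.mem_nhds hz

theorem one_sub_mul_mem_slitPlane {z w : ℂ} (hz : z ∈ disk) (hw : w ∈ disk) :
    1 - z * w ∈ Complex.slitPlane := by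
  rw [mem_ball_zero_iff] at hz hw
  have : ‖-(z * w)‖ < 1 := by
    rw [norm_neg, norm_mul]
    nlinarith [norm_nonneg z, norm_nonneg w]
  simpa [sub_eq_add_neg] using Complex.mem_slitPlane_of_norm_lt_one this

theorem iteratedDeriv_grunskyLog_koebe {ζ : ℂ} (hζ : ζ ∈ disk) (q : ℕ) {z : ℂ} (hz : z ∈ disk) :
    iteratedDeriv (q + 1) (fun ω => grunskyLog koebe ζ ω) z
      = -((q.factorial : ℂ) * ζ ^ (q + 1) / (1 - ζ * z) ^ (q + 1)) := by
  induction q generalizing z with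
  | zero =>
    have he : (fun ω => grunskyLog koebe ζ ω) =ᶠ[nhds z] fun ω => Complex.log (1 - ζ * ω) := by
      filter_upwards [disk_mem_nhds hz] with ω hω using grunskyLog_koebe hζ hω
    have h1 : HasDerivAt (fun ω : ℂ => 1 - ζ * ω) (-ζ) z := by
      simpa using ((hasDerivAt_id z).const_mul ζ).const_sub 1
    rw [zero_add, iteratedDeriv_one, he.deriv_eq,
      (h1.clog (one_sub_mul_mem_slitPlane hζ hz)).deriv]
    simp [neg_div]
  | succ q ih =>
    -- The factor `ω ^ 0` and the swapped variables bring the expression into the form of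
    -- `hasDerivAt_pow_mul_div_one_sub_mul`.
    have he : iteratedDeriv (q + 1) (fun ω => grunskyLog koebe ζ ω) =ᶠ[nhds z]
        fun ω => -((q.factorial : ℂ) * ω ^ 0 * ζ ^ (q + 1) / (1 - ω * ζ) ^ (q + 1)) := by
      filter_upwards [disk_mem_nhds hz] with ω hω
      rw [ih hω, pow_zero, mul_one, mul_comm ω]
    rw [iteratedDeriv_succ, he.deriv_eq,
      (hasDerivAt_pow_mul_div_one_sub_mul hz hζ _ _ _ _).fun_neg.deriv, Nat.factorial_succ]
    push_cast
    ring

/-- The derivatives of `ζ ^ q / (1 - ζ ω) ^ q` have numerators with nonnegative coefficients. -/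
theorem exists_iteratedDeriv_pow_div (q : ℕ) (p : ℕ) :
    ∃ a : ℕ → ℝ, (∀ m, 0 ≤ a m) ∧ (∀ m, a m ≠ 0 → m ≤ q + 1 ∧ q + 1 ≤ m + p) ∧
      ∑ m ∈ Finset.range (q + 2), a m = ((p + q).factorial : ℝ) ∧
      ∀ w ∈ disk, ∀ z ∈ disk,
        iteratedDeriv p (fun ζ => (q.factorial : ℂ) * ζ ^ (q + 1) / (1 - ζ * w) ^ (q + 1)) z
          = ∑ m ∈ Finset.range (q + 2), (a m : ℂ) * z ^ m * w ^ (m + p - (q + 1))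
            / (1 - z * w) ^ (p + (q + 1)) := by
  induction p with
  | zero =>
    refine ⟨fun m => if m = q + 1 then (q.factorial : ℝ) else 0, fun m => ?_, fun m hm => ?_, ?_,
      fun w hw z hz => ?_⟩
    · dsimp only
      split_ifs <;> positivity
    · have : m = q + 1 := by
        by_contra h
        simp [h] at hm
      omega
    · rw [Finset.sum_ite_eq' _ _ (fun _ => (q.factorial : ℝ))]
      simp
    · rw [iteratedDeriv_zero, Finset.sum_range_succ, Finset.sum_eq_zero]
      · simp
      · intro m hm
        simp [(Finset.mem_range.1 hm).ne]
  | succ p ih =>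
    obtain ⟨a, ha0, hsupp, hsum, hd⟩ := ih
    have htop : a (q + 2) = 0 := by
      by_contra h
      have := (hsupp _ h).1
      omega
    -- With `N = p + q + 1`, differentiating `z ^ m w ^ k / (1 - z w) ^ N` gives the numerator `m z
    -- ^ (m - 1) w ^ k + (N - m) z ^ m w ^ (k + 1)`. Both coefficients are nonnegative as `m ≤ q + 1
    -- ≤ N`, and they add up to `N`, so the coefficient sum grows from `(p + q)!` to `(p + q + 1)!`.
    refine ⟨fun m => (m + 1) * a (m + 1) + (p + (q + 1) - m) * a m, fun m => ?_, fun m hm => ?_, ?_,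
      fun w hw z hz => ?_⟩
    · dsimp only
      by_cases hm : a m = 0
      · rw [hm, mul_zero, add_zero]
        exact mul_nonneg (by positivity) (ha0 _)
      · have : (m : ℝ) ≤ q + 1 := by exact_mod_cast (hsupp m hm).1
        have hp : (0 : ℝ) ≤ p := p.cast_nonneg
        exact add_nonneg (mul_nonneg (by positivity) (ha0 _))
          (mul_nonneg (by linarith) (ha0 _))
    · by_cases h1 : a (m + 1) = 0
      · have h2 : a m ≠ 0 := by
          intro h2
          simp [h1, h2] at hm
        have := hsupp m h2
        omega
      · have := hsupp (m + 1) h1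
        omega
    · have hshift : ∑ m ∈ Finset.range (q + 2), ((m : ℝ) + 1) * a (m + 1)
          = ∑ m ∈ Finset.range (q + 2), (m : ℝ) * a m := by
        have h1 := Finset.sum_range_succ' (fun m : ℕ => (m : ℝ) * a m) (q + 2)
        rw [Finset.sum_range_succ, htop] at h1
        simpa using h1.symm
      rw [Finset.sum_add_distrib, hshift, ← Finset.sum_add_distrib,
        show p + 1 + q = p + q + 1 by ring, Nat.factorial_succ, Nat.cast_mul, ← hsum,
        Finset.mul_sum]
      refine Finset.sum_congr rfl fun m _ => ?_
      push_cast
      ring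
    · have he : iteratedDeriv p
          (fun ζ => (q.factorial : ℂ) * ζ ^ (q + 1) / (1 - ζ * w) ^ (q + 1)) =ᶠ[nhds z]
          fun ζ => ∑ m ∈ Finset.range (q + 2), (a m : ℂ) * ζ ^ m * w ^ (m + p - (q + 1))
            / (1 - ζ * w) ^ (p + (q + 1)) := by
        filter_upwards [disk_mem_nhds hz] with ζ hζ using hd w hw ζ hζ
      rw [iteratedDeriv_succ, he.deriv_eq, (HasDerivAt.fun_sum fun m _ =>
        hasDerivAt_pow_mul_div_one_sub_mul hz hw (a m) m (m + p - (q + 1)) _).deriv]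
      rw [← Finset.sum_div, ← Finset.sum_div, show p + 1 + (q + 1) = p + (q + 1) + 1 by ring]
      congr 1
      have hshift : ∑ m ∈ Finset.range (q + 2),
            ((m : ℂ) + 1) * a (m + 1) * z ^ m * w ^ (m + (p + 1) - (q + 1))
          = ∑ m ∈ Finset.range (q + 2), (m : ℂ) * a m * z ^ (m - 1) * w ^ (m + p - (q + 1)) := by
        have h1 := Finset.sum_range_succ' (fun m : ℕ => (m : ℂ) * a m * z ^ (m - 1)
          * w ^ (m + p - (q + 1))) (q + 2)
        rw [Finset.sum_range_succ, htop] at h1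
        simp only [Complex.ofReal_zero, mul_zero, zero_mul, add_zero, Nat.cast_zero] at h1
        rw [h1]
        refine Finset.sum_congr rfl fun m _ => ?_
        rw [show m + 1 + p = m + (p + 1) by ring]
        push_cast
        simp
      have hsplit : ∑ m ∈ Finset.range (q + 2), (((m + 1) * a (m + 1) + (p + (q + 1) - m) * a m : ℝ) : ℂ)
            * z ^ m * w ^ (m + (p + 1) - (q + 1))
          = ∑ m ∈ Finset.range (q + 2),
              ((m : ℂ) + 1) * a (m + 1) * z ^ m * w ^ (m + (p + 1) - (q + 1))
            + ∑ m ∈ Finset.range (q + 2),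
              ((p : ℂ) + (q + 1) - m) * a m * z ^ m * w ^ (m + (p + 1) - (q + 1)) := by
        rw [← Finset.sum_add_distrib]
        refine Finset.sum_congr rfl fun m _ => ?_
        push_cast
        ring
      rw [hsplit, hshift, ← Finset.sum_add_distrib]
      refine Finset.sum_congr rfl fun m _ => ?_
      -- The natural subtraction in the exponent of `w` is faithful only where `a m ≠ 0`.
      by_cases hm : a m = 0
      · simp [hm]
      · obtain ⟨k, hk⟩ : ∃ k, m + p = q + 1 + k := Nat.exists_eq_add_of_le (hsupp m hm).2
        rw [show m + (p + 1) - (q + 1) = k + 1 by omega, show m + p - (q + 1) = k by omega]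
        rcases m with _ | m
        · simp
        · simp only [Nat.add_sub_cancel]
          push_cast
          ring

theorem exists_higherSchwarzian_koebe_eq {p q : ℕ} (hq : 1 ≤ q) :
    ∃ a : ℕ → ℝ, (∀ m, 0 ≤ a m) ∧ (∀ m, a m ≠ 0 → m ≤ q ∧ q ≤ m + p) ∧
      ∑ m ∈ Finset.range (q + 1), a m = ((p + q - 1).factorial : ℝ) ∧
      ∀ z ∈ disk, higherSchwarzian koebe p q z
        = -(∑ m ∈ Finset.range (q + 1), (a m : ℂ) * z ^ (m + (m + p - q)))
          / (1 - z ^ 2) ^ (p + q) := by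
  obtain ⟨q, rfl⟩ := Nat.exists_eq_add_of_le' hq
  obtain ⟨a, ha0, hsupp, hsum, hd⟩ := exists_iteratedDeriv_pow_div q p
  refine ⟨a, ha0, hsupp, hsum, fun z hz => ?_⟩
  have he : (fun ζ => iteratedDeriv (q + 1) (fun ω => grunskyLog koebe ζ ω) z) =ᶠ[nhds z]
      -(fun ζ => (q.factorial : ℂ) * ζ ^ (q + 1) / (1 - ζ * z) ^ (q + 1)) := by
    filter_upwards [disk_mem_nhds hz] with ζ hζ using iteratedDeriv_grunskyLog_koebe hζ q hz
  rw [higherSchwarzian, he.iteratedDeriv_eq, iteratedDeriv_neg, hd z hz z hz, ← Finset.sum_div,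
    neg_div, ← pow_two]
  simp only [pow_add, mul_assoc]

/-! ### The constant and the conclusion -/

/-- The Gamma quotients and `4 ^ n` combine to the product of `(α + 2 i + 3) / (α + 2 i + 2)`. Its
numerators are those of `koebeProd` shifted by one index, whence the factor `(α + 2 n + 1) / (α +
1)`, which is also the ratio of the normalizations. -/
theorem koebeConst_eq {α : ℝ} (hα : -1 < α) (p q : ℕ) :
    koebeConst α p q = ((p + q - 1).factorial : ℝ) ^ 2 * koebeProd α (p + q)
      * ((α + 2 * (p + q : ℕ) + 1) / (α + 1)) := by
  have key : ∀ n : ℕ, Real.Gamma (α + 2 + 2 * n) / Real.Gamma (α + 2)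
      * (Real.Gamma (α / 2 + 1) / Real.Gamma (α / 2 + 1 + n)) ^ 2 / 4 ^ n
      = koebeProd α n * ((α + 2 * n + 1) / (α + 1)) := by
    intro n
    have h1 : Real.Gamma (α + 2) ≠ 0 := (Real.Gamma_pos_of_pos (by linarith)).ne'
    have h2 : Real.Gamma (α / 2 + 1) ≠ 0 := (Real.Gamma_pos_of_pos (by linarith)).ne'
    have h3 : α + 1 ≠ 0 := by linarith
    induction n with
    | zero => simp [koebeProd, h1, h2, h3]
    | succ n ih =>
      have hn : (0 : ℝ) ≤ n := n.cast_nonneg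
      have h4 : α + 2 * n + 1 ≠ 0 := by linarith
      have h5 : α + 2 * n + 2 ≠ 0 := by linarith
      have h6 : Real.Gamma (α / 2 + 1 + n) ≠ 0 := (Real.Gamma_pos_of_pos (by linarith)).ne'
      have h7 : α / 2 + 1 + n ≠ 0 := by linarith
      have e1 : Real.Gamma (α + 2 + 2 * (n + 1 : ℕ))
          = (α + 2 * n + 3) * ((α + 2 * n + 2) * Real.Gamma (α + 2 + 2 * n)) := by
        rw [show α + 2 + 2 * ((n + 1 : ℕ) : ℝ) = α + 2 + 2 * n + 1 + 1 by push_cast; ring,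
          Real.Gamma_add_one (by linarith), Real.Gamma_add_one (by linarith)]
        ring
      have e2 : Real.Gamma (α / 2 + 1 + (n + 1 : ℕ))
          = (α + 2 * n + 2) / 2 * Real.Gamma (α / 2 + 1 + n) := by
        rw [show α / 2 + 1 + ((n + 1 : ℕ) : ℝ) = α / 2 + 1 + n + 1 by push_cast; ring,
          Real.Gamma_add_one h7]
        ring
      have e3 : koebeProd α (n + 1) = koebeProd α n * ((α + 2 * n + 1) / (α + 2 * n + 2)) :=
        Finset.prod_range_succ _ _
      calc _ = (Real.Gamma (α + 2 + 2 * n) / Real.Gamma (α + 2)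
            * (Real.Gamma (α / 2 + 1) / Real.Gamma (α / 2 + 1 + n)) ^ 2 / 4 ^ n)
            * ((α + 2 * n + 3) / (α + 2 * n + 2)) := by
            rw [e1, e2, pow_succ]
            generalize Real.Gamma (α / 2 + 1 + n) = X at h6
            generalize Real.Gamma (α / 2 + 1) = Y
            field_simp
            ring
        _ = _ := by
            rw [ih, e3]
            push_cast
            field_simp
            ring
  have h := key (p + q)
  rw [mul_assoc, ← h, koebeConst, show 2 * p + 2 * q = 2 * (p + q) by ring, pow_mul]
  push_cast
  rw [show α + 2 + 2 * (p : ℝ) + 2 * q = α + 2 + 2 * (p + q) by ring,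
    show α / 2 + 1 + (p : ℝ) + q = α / 2 + 1 + (p + q) by ring]
  norm_num
  ring

theorem schwarzian_koebe {z : ℂ} (hz : z ∈ disk) :
    schwarzian koebe z = -6 / (1 - z ^ 2) ^ 2 := by
  have hne : ∀ z ∈ disk, (1 : ℂ) - z ≠ 0 ∧ (1 : ℂ) + z ≠ 0 := by
    intro z hz
    have h : (1 - z) * (1 + z) ≠ 0 := by
      convert one_sub_sq_ne_zero hz using 1
      ring
    exact ⟨left_ne_zero_of_mul h, right_ne_zero_of_mul h⟩
  have hd1 : ∀ z ∈ disk, deriv koebe z = (1 + z) / (1 - z) ^ 3 := by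
    intro z hz
    have h1 := (hne z hz).1
    have h := (hasDerivAt_id z).div (((hasDerivAt_id z).const_sub 1).pow 2) (pow_ne_zero 2 h1)
    refine (h.congr_deriv ?_).deriv
    simp only [id, Pi.pow_apply]
    field_simp
    push_cast
    ring
  have hd2 : ∀ z ∈ disk, deriv (deriv koebe) z = (2 * z + 4) / (1 - z) ^ 4 := by
    intro z hz
    have h1 := (hne z hz).1
    have he : deriv koebe =ᶠ[nhds z] fun z => (1 + z) / (1 - z) ^ 3 := by
      filter_upwards [disk_mem_nhds hz] with ζ hζ using hd1 ζ hζ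
    rw [he.deriv_eq]
    have h := ((hasDerivAt_id z).const_add 1).div (((hasDerivAt_id z).const_sub 1).pow 3)
      (pow_ne_zero 3 h1)
    refine (h.congr_deriv ?_).deriv
    simp only [id, Pi.pow_apply]
    field_simp
    push_cast
    ring
  have hq : ∀ z ∈ disk, deriv (deriv koebe) z / deriv koebe z = (2 * z + 4) / (1 - z ^ 2) := by
    intro z hz
    obtain ⟨h1, h2⟩ := hne z hz
    rw [hd1 z hz, hd2 z hz, show 1 - z ^ 2 = (1 - z) * (1 + z) by ring]
    field_simp
  have he : (fun ζ => deriv (deriv koebe) ζ / deriv koebe ζ) =ᶠ[nhds z]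
      fun z => (2 * z + 4) / (1 - z ^ 2) := by
    filter_upwards [disk_mem_nhds hz] with ζ hζ using hq ζ hζ
  have h0 := one_sub_sq_ne_zero hz
  have h := (((hasDerivAt_id z).const_mul 2).add_const 4).div ((hasDerivAt_pow 2 z).const_sub 1) h0
  have h' : HasDerivAt (fun z : ℂ => (2 * z + 4) / (1 - z ^ 2))
      ((2 + 8 * z + 2 * z ^ 2) / (1 - z ^ 2) ^ 2) z := by
    refine h.congr_deriv ?_
    simp only [id]
    push_cast
    ring
  rw [schwarzian, he.deriv_eq, hq z hz, h'.deriv]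
  field_simp
  ring

theorem theorem2p1 (α : ℝ) (hα : -1 < α) :
    (∀ p q : ℕ, 1 ≤ p → 1 ≤ q →
      IsMultiplier α (α + 2 * p + 2 * q) (higherSchwarzian koebe p q) ∧
      multiplierNorm α (α + 2 * p + 2 * q) (higherSchwarzian koebe p q)
        = √(koebeConst α p q)) ∧
    (IsMultiplier α (α + 4) (schwarzian koebe) ∧
      multiplierNorm α (α + 4) (schwarzian koebe) ^ 2
        = 36 * (α + 3) * (α + 5) / ((α + 2) * (α + 4))) := by
  constructor
  · intro p q hp hq
    obtain ⟨a, ha0, hsupp, hsum, hS⟩ := exists_higherSchwarzian_koebe_eq (p := p) hq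
    have h := multiplierNorm_of_eq_sum_div hα (n := p + q) (by omega)
      -- Here `n + e m = (p + q) + (2 m + p - q) = 2 (m + p)` on the support of `a`.
      (S := Finset.range (q + 1)) (w := a) (f := fun m => m + p) (fun m _ => ha0 m)
      (fun m hm => by have := Finset.mem_range.1 hm; omega)
      (fun m _ hm => by have := hsupp m hm; omega) (by rw [hsum]; positivity) hS
    rw [hsum, ← koebeConst_eq hα] at h
    rwa [show α + 2 * ((p + q : ℕ) : ℝ) = α + 2 * p + 2 * q by push_cast; ring] at h
  -- The Schwarzian is `-6 / (1 - z²) ^ 2`, with the single weight `6` and exponent `0`, so the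
  -- general result applies directly.
  · have h := multiplierNorm_of_eq_sum_div hα (n := 2) (by omega) (S := {0}) (w := fun _ => 6)
      (e := fun _ => 0) (f := fun _ => 1) (g := schwarzian koebe) (by simp) (by simp) (by simp)
      (by simp) (fun z hz => by rw [schwarzian_koebe hz]; simp)
    rw [show α + 2 * ((2 : ℕ) : ℝ) = α + 4 by push_cast; ring] at h
    refine ⟨h.1, ?_⟩
    have h1 : 0 < α + 1 := by linarith
    have h2 : α + 2 ≠ 0 := by linarith
    have h3 : α + 4 ≠ 0 := by linarith
    have h4 : 0 ≤ α + 4 + 1 := by linarith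
    have hK := koebeProd_pos hα 2
    have hK2 : koebeProd α 2 = (α + 1) / (α + 2) * ((α + 3) / (α + 4)) := by
      rw [koebeProd, Finset.prod_range_succ, Finset.prod_range_one]
      push_cast
      congr 2 <;> ring
    rw [h.2, Real.sq_sqrt (by positivity), hK2, Finset.sum_singleton]
    field_simp
    ring
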